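/- Setting. Consider a power network with buses $1,\dots,n_b$ and $n$ branches, branch $l$ joining the distinct buses $i_l$ and $j_l$. Let $A\in\mathbb R^{n\times n_b}$ be its branch-bus incidence matrix (row $l$ has entry $1$ at $i_l$, $-1$ at $j_l$ and $0$ elsewhere), and let $\mathcal E$ be the set of pairs $(i,j)$ of buses that are connected by a branch. For branch admittances $Y\in\mathbb R^n$ and injected power $P\in\mathbb R^{n_b}$ put $$P_{ij}(Y,P)=e_i^TA^T\mathrm{diag}(Y)Ae_j\,(e_i-e_j)^T\left(A^T\mathrm{diag}(Y)A\right)^{-1^*}P ,$$ where $(\cdot)^{-1^*}$ is obtained by deleting, in every connected component of the network of branches with nonzero admittance, the row and column of a reference bus (the one of smallest index), inverting what remains, and filling the deleted entries with zeros. Let $P^0\in\mathbb R^{n_b}$ be the original injected power, $Y^0$ the original admittances, $\delta$ the initial disturbance, $Y^1=Y^0+\delta$, and for $k\ge 1$ let $Y^{k+1}_l=g(P_{i_lj_l}(Y^k,P^0),c_{i_lj_l})\,Y^k_l$, where, for the tunable parameter $\sigma$ of the cascading model, $g(x,c)=0$ if $|x|\ge\sqrt{c^2+\frac{\pi}{2\sigma}}$,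 $g(x,c)=1$ if $|x|\le\sqrt{c^2-\frac{\pi}{2\sigma}}$, and $g(x,c)=\frac12\left(1-\sin\sigma(x^2-c^2)\right)$ otherwise. Fix a cascading step $m$ and write $P^m_{ij}=P_{ij}(Y^m,P)$, a linear function of $P$. Given weights $W_i>0$, thresholds $\sigma_{ij}>0$ for $(i,j)\in\mathcal E$ and bounds $\underline P_i,\bar P_i$, consider the load-shedding problem $$\min_P\ J(P)=\|W\circ(P-P^0)\|^2\quad\text{s.t.}\quad (P^m_{ij})^2\le\sigma_{ij}^2\ \ ((i,j)\in\mathcal E),\qquad \underline P_i\le P_i\le\bar P_i\ \ (1\le i\le n_b),$$ whose feasible region is assumed to be nonempty, and its Lagrangian $$L(P,\lambda,\tau)=J(P)+\sum_{(i,j)\in\mathcal E}\lambda_{ij}\left[(P^m_{ij})^2-\sigma_{ij}^2\right]+\sum_i\bar\tau_i(P_i-\bar P_i)+\sum_i\underline\tau_i(\underline P_i-P_i),\qquad \tau=(\bar\tau,\underline\tau).$$ The saddle point dynamics is $$\dot P=-\nabla_PL(P,\lambda,\tau),\qquad \dot\lambda_{ij}=[\partial_{\lambda_{ij}}L]^+_{\lambda_{ij}},\qquad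 \dot{\bar\tau}_i=[\partial_{\bar\tau_i}L]^+_{\bar\tau_i},\qquad \dot{\underline\tau}_i=[\partial_{\underline\tau_i}L]^+_{\underline\tau_i},$$ where $[x]^+_y=x$ if $y>0$ and $[x]^+_y=\max\{x,0\}$ if $y=0$. Its state space is $\{(P,\lambda,\tau):\lambda\ge0,\ \tau\ge0\}$, and a solution is a locally absolutely continuous function on $[0,\infty)$ with values in the state space that satisfies the equations for almost every $t$. Proposition. The load-shedding problem has a unique optimal solution $P^*$, and the saddle point dynamics globally asymptotically converges to it. That is: (i) for every initial state with nonnegative multipliers there is a solution on $[0,\infty)$; (ii) every solution $(P(t),\lambda(t),\tau(t))$ converges, as $t\to\infty$, to a saddle point $(P^*,\lambda^*,\tau^*)$ of $L$ (minimum over all $P$, maximum over all nonnegative multipliers), so that in particular $P(t)\to P^*$; (iii) every saddle point of $L$ is Lyapunov stable: for each $\varepsilon>0$ there is $\delta'>0$ such that every solution that starts within $\delta'$ of it stays within $\varepsilon$ of it. -/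

import Mathlib

open Filter Topology MeasureTheory

noncomputable section

/-- Data of the load-shedding problem: a power network with `nb` buses and `n` branches, the
parameters of the cascading model, and the parameters of the optimization problem. -/
structure PowerGrid (nb n : ℕ) where
  /-- the two end buses of each branch -/
  src : Fin n → Fin nb
  tgt : Fin n → Fin nb
  src_ne_tgt : ∀ l, src l ≠ tgt l
  /-- original branch admittances -/
  Y0 : Fin n → ℝ
  /-- initial disturbance of the branch admittances -/
  δ : Fin n → ℝ
  /-- power thresholds in the cascading model -/
  c : Fin nb → Fin nb → ℝ
  /-- tunable parameter of the smoothed outage function -/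
  sharpness : ℝ
  /-- original injected power on each bus -/
  P0 : EuclideanSpace ℝ (Fin nb)
  /-- weights of the buses -/
  W : Fin nb → ℝ
  /-- power thresholds in the optimization problem -/
  σ : Fin nb → Fin nb → ℝ
  /-- lower and upper bounds of the injected power -/
  Plo : Fin nb → ℝ
  Phi : Fin nb → ℝ

/-- The smoothed outage function of a branch with transmission power `x` and threshold `c`;
`s` is the tunable parameter. -/
def outage (s x c : ℝ) : ℝ :=
  if √(c ^ 2 + Real.pi / (2 * s)) ≤ |x| then 0
  else if |x| ≤ √(c ^ 2 - Real.pi / (2 * s)) then 1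
  else (1 - Real.sin (s * (x ^ 2 - c ^ 2))) / 2

/-- The switching operator `[x]⁺_y` (used for `0 ≤ y`). -/
def projPlus (x y : ℝ) : ℝ := if 0 < y then x else max x 0

namespace PowerGrid

variable {nb n : ℕ} (N : PowerGrid nb n)

/-- The set `ℰ` of pairs of buses that are connected by a branch. -/
abbrev Edge : Type :=
  {p : Fin nb × Fin nb //
    ∃ l, (N.src l = p.1 ∧ N.tgt l = p.2) ∨ (N.src l = p.2 ∧ N.tgt l = p.1)}

/-- Branch-bus incidence matrix `A`. -/
def incidence : Matrix (Fin n) (Fin nb) ℝ :=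
  fun l i => if i = N.src l then 1 else if i = N.tgt l then -1 else 0

/-- Nodal admittance matrix `Aᵀ diag(Y) A`. -/
def nodal (Y : Fin n → ℝ) : Matrix (Fin nb) (Fin nb) ℝ :=
  N.incidence.transpose * Matrix.diagonal Y * N.incidence

/-- The graph of the branches in service. -/
def liveGraph (Y : Fin n → ℝ) : SimpleGraph (Fin nb) :=
  SimpleGraph.fromRel fun i j => ∃ l, Y l ≠ 0 ∧ N.src l = i ∧ N.tgt l = j

/-- The reference bus of each connected subnetwork: its bus of smallest index. -/
def IsRef (Y : Fin n → ℝ) (i : Fin nb) : Prop :=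
  ∀ j, (N.liveGraph Y).Reachable i j → i ≤ j

/-- The nodal admittance matrix without the rows and columns of the reference buses. -/
def reducedNodal (Y : Fin n → ℝ) : Matrix {b // ¬ N.IsRef Y b} {b // ¬ N.IsRef Y b} ℝ :=
  fun i j => N.nodal Y i.1 j.1

open Classical in
/-- The inverse `(Aᵀ diag(Y) A)^{-1*}` of the (singular) nodal admittance matrix: in every connected
subnetwork the row and the column of the reference bus are deleted, what remains is inverted, and
the deleted entries are filled with zeros. As the nodal matrix has no entries between different
subnetworks, all the subnetworks can be inverted at once. -/
def starInv (Y : Fin n → ℝ) : Matrix (Fin nb) (Fin nb) ℝ :=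
  fun i j =>
    if h : ¬ N.IsRef Y i ∧ ¬ N.IsRef Y j then (N.reducedNodal Y)⁻¹ ⟨i, h.1⟩ ⟨j, h.2⟩ else 0

/-- Transmission power between Buses `i` and `j` for branch admittances `Y` and injected power `P`:
`eᵢᵀ Aᵀ diag(Y) A eⱼ (eᵢ - eⱼ)ᵀ (Aᵀ diag(Y) A)^{-1*} P`. -/
def flow (Y : Fin n → ℝ) (P : EuclideanSpace ℝ (Fin nb)) (i j : Fin nb) : ℝ :=
  N.nodal Y i j * ((N.starInv Y).mulVec P.ofLp i - (N.starInv Y).mulVec P.ofLp j)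

/-- Branch admittances `Y_p^k` at the `k`-th cascading step. Before remedial measures are taken the
injected power is the original one. -/
def admittance : ℕ → Fin n → ℝ
  | 0 => N.Y0
  | 1 => N.Y0 + N.δ
  | k + 2 => fun l =>
      outage N.sharpness (N.flow (admittance (k + 1)) N.P0 (N.src l) (N.tgt l))
        (N.c (N.src l) (N.tgt l)) * admittance (k + 1) l

/-- Transmission power `P^m_{ij}` at the `m`-th cascading step, with injected power `P`. -/
def flowAt (m : ℕ) (P : EuclideanSpace ℝ (Fin nb)) (i j : Fin nb) : ℝ :=
  N.flow (N.admittance m) P i j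

/-- Cost `J(P, W) = ‖W ∘ (P - P⁰)‖²`. -/
def cost (P : EuclideanSpace ℝ (Fin nb)) : ℝ :=
  ‖WithLp.toLp 2 (fun i => N.W i * (P i - N.P0 i))‖ ^ 2

/-- Feasible region of the load-shedding problem at the `m`-th cascading step. -/
def feasible (m : ℕ) : Set (EuclideanSpace ℝ (Fin nb)) :=
  {P | (∀ e : N.Edge, N.flowAt m P e.1.1 e.1.2 ^ 2 ≤ N.σ e.1.1 e.1.2 ^ 2) ∧
    ∀ i, N.Plo i ≤ P i ∧ P i ≤ N.Phi i}

/-- `P` is an optimal solution to the load-shedding problem. -/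
def IsOptimal (m : ℕ) (P : EuclideanSpace ℝ (Fin nb)) : Prop :=
  P ∈ N.feasible m ∧ IsMinOn N.cost (N.feasible m) P

/-- Lagrangian function; `tu` and `tl` are the multipliers of the upper and of the lower bounds. -/
def lagrangian (m : ℕ) (P : EuclideanSpace ℝ (Fin nb)) (lam : EuclideanSpace ℝ N.Edge)
    (tu tl : EuclideanSpace ℝ (Fin nb)) : ℝ :=
  N.cost P + ∑ e : N.Edge, lam e * (N.flowAt m P e.1.1 e.1.2 ^ 2 - N.σ e.1.1 e.1.2 ^ 2)
    + ∑ i, tu i * (P i - N.Phi i) + ∑ i, tl i * (N.Plo i - P i)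

/-- States `(P, λ, τ̄, τ̲)` of the saddle point dynamics. -/
abbrev State : Type :=
  EuclideanSpace ℝ (Fin nb) × EuclideanSpace ℝ N.Edge ×
    EuclideanSpace ℝ (Fin nb) × EuclideanSpace ℝ (Fin nb)

/-- All the multipliers of the state are nonnegative. -/
def MultNonneg (z : N.State) : Prop :=
  (∀ e, 0 ≤ z.2.1 e) ∧ (∀ i, 0 ≤ z.2.2.1 i) ∧ ∀ i, 0 ≤ z.2.2.2 i

/-- `z` is a saddle point of the Lagrangian function, which is minimized over all `P` and maximized
over all nonnegative multipliers. -/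
def IsSaddlePoint (m : ℕ) (z : N.State) : Prop :=
  N.MultNonneg z ∧
    ∀ w : N.State, N.MultNonneg w →
      N.lagrangian m z.1 w.2.1 w.2.2.1 w.2.2.2 ≤ N.lagrangian m z.1 z.2.1 z.2.2.1 z.2.2.2 ∧
      N.lagrangian m z.1 z.2.1 z.2.2.1 z.2.2.2 ≤ N.lagrangian m w.1 z.2.1 z.2.2.1 z.2.2.2

/-- Right-hand side of the saddle point dynamics: gradient descent in `P`, projected gradient ascent
in the multipliers. -/
def saddleField (m : ℕ) (z : N.State) : N.State :=
  (-gradient (fun P => N.lagrangian m P z.2.1 z.2.2.1 z.2.2.2) z.1,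
    WithLp.toLp 2 (fun e =>
      projPlus (gradient (fun lam => N.lagrangian m z.1 lam z.2.2.1 z.2.2.2) z.2.1 e) (z.2.1 e)),
    WithLp.toLp 2 (fun i =>
      projPlus (gradient (fun tu => N.lagrangian m z.1 z.2.1 tu z.2.2.2) z.2.2.1 i) (z.2.2.1 i)),
    WithLp.toLp 2 (fun i =>
      projPlus (gradient (fun tl => N.lagrangian m z.1 z.2.1 z.2.2.1 tl) z.2.2.2 i) (z.2.2.2 i)))

/-- `z` is a solution on `[0, ∞)` of the saddle point dynamics, in the sense of Carathéodory (the
right-hand side is discontinuous where a multiplier vanishes). The multipliers stay in the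
nonnegative orthant, where the right-hand side is defined. -/
structure IsTrajectory (m : ℕ) (z : ℝ → N.State) : Prop where
  absCont : ∀ T, 0 < T → AbsolutelyContinuousOnInterval z 0 T
  nonneg : ∀ t, 0 ≤ t → N.MultNonneg (z t)
  ode : ∀ᵐ t : ℝ, 0 < t → HasDerivAt z (N.saddleField m (z t)) t

end PowerGrid

end

/-!
The squared distance from a trajectory to a saddle point `(x*, y*)` of a convex program decreases at
least at twice the rate of the duality gap `L (x, y*) - L (x*, y)`. Hence trajectories stay bounded,
saddle points are stable, and by Barbalat's lemma the gap tends to `0`, which forces `x → x*` by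
strict convexity. A second use of Barbalat's lemma shows that `∇ₓ L → 0` along the trajectory, so a
cluster point `(x*, b)` is again a saddle point; the distance to it is monotone as well, and
therefore the whole trajectory converges to it.

Trajectories exist because the discontinuous projection can be written with the one-dimensional
Skorokhod map in each multiplier, which turns the dynamics into a causal Lipschitz functional
differential equation once the field is truncated outside a ball. Saddle points exist without
Slater's condition: every constraint of the load-shedding problem is affine or the square of a
linear form that does not vanish where the constraint is active, so by Farkas' lemma the minimizer
has multipliers.
-/

noncomputable section

section Farkas

variable {𝕜 V ι : Type*} [Field 𝕜] [LinearOrder 𝕜] [IsStrictOrderedRing 𝕜] [AddCommGroup V]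
  [Module 𝕜 V]

open Module PointedCone

theorem apply_nonpos_of_mem_hull {s : Set (Dual 𝕜 V)} {g : Dual 𝕜 V} (hg : g ∈ hull 𝕜 s)
    {v : V} (hv : ∀ φ ∈ s, φ v ≤ 0) : g v ≤ 0 := by
  induction hg using Submodule.span_induction with
  | mem φ h => exact hv φ h
  | zero => exact le_rfl
  | add φ ψ _ _ hφ hψ => exact add_nonpos hφ hψ
  | smul c φ _ hφ => exact mul_nonpos_of_nonneg_of_nonpos c.2 hφ

/-- The inductive step of Farkas' lemma: `ψ - (ψ v / φ v) • φ` is `ψ` composed with the projection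
onto the kernel of `φ` along `v`. -/
theorem mem_hull_insert_of_mem_hull_image {s : Set (Dual 𝕜 V)} {φ g : Dual 𝕜 V} {v : V}
    (hφ : 0 < φ v) (hs : ∀ ψ ∈ s, ψ v ≤ 0) (hgv : 0 ≤ g v)
    (hg : g - (g v / φ v) • φ ∈ hull 𝕜 ((fun ψ => ψ - (ψ v / φ v) • φ) '' s)) :
    g ∈ hull 𝕜 (insert φ s) := by
  let T : Dual 𝕜 V →ₗ[𝕜] Dual 𝕜 V :=
    LinearMap.id - ((φ v)⁻¹ • Dual.eval 𝕜 V v).smulRight φ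
  have hT (ψ : Dual 𝕜 V) : T ψ = ψ - (ψ v / φ v) • φ := by
    simp [T, div_eq_inv_mul]
  simp only [← hT] at hg
  obtain ⟨h, hh, hTh⟩ : ∃ h ∈ hull 𝕜 s, T h = T g := by
    rw [hull, ← LinearMap.coe_restrictScalars {c : 𝕜 // 0 ≤ c} T, ← Submodule.map_span] at hg
    exact hg
  rw [hT, hT] at hTh
  have hhv : h v ≤ 0 := apply_nonpos_of_mem_hull hh hs
  refine Submodule.mem_span_insert.2
    ⟨⟨(g v - h v) / φ v, div_nonneg (by linarith) hφ.le⟩, h, hh, ?_⟩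
  rw [Nonneg.mk_smul, sub_div, sub_smul]
  linear_combination (norm := module) -hTh

theorem mem_hull_image_of_forall_nonpos (s : Finset ι) (f : ι → Dual 𝕜 V) (g : Dual 𝕜 V)
    (h : ∀ v, (∀ i ∈ s, f i v ≤ 0) → g v ≤ 0) : g ∈ hull 𝕜 (f '' s) := by
  classical
  induction s using Finset.induction_on generalizing f g with
  | empty =>
    have hg : g = 0 := by
      ext v
      have h' := h (-v) (by simp)
      rw [map_neg] at h'
      exact le_antisymm (h v (by simp)) (by simpa using h')
    exact hg ▸ zero_mem _
  | insert a s _ ih =>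
    rw [Finset.coe_insert, Set.image_insert_eq]
    by_cases hs : ∀ v, (∀ i ∈ s, f i v ≤ 0) → g v ≤ 0
    · exact Submodule.span_mono (Set.subset_insert _ _) (ih f g hs)
    push Not at hs
    obtain ⟨v, hv, hgv⟩ := hs
    have hav : 0 < f a v := by
      by_contra! hcon
      exact hgv.not_ge (h v (Finset.forall_mem_insert .. |>.2 ⟨hcon, hv⟩))
    refine mem_hull_insert_of_mem_hull_image hav (by simpa using hv) hgv.le ?_
    rw [Set.image_image]
    refine ih _ _ fun x hx => ?_
    have hx' := h (x - (f a x / f a v) • v) (Finset.forall_mem_insert .. |>.2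
      ⟨by simp [hav.ne'], fun i hi => ?_⟩)
    · simpa [div_mul_comm] using hx'
    · simpa [div_mul_comm] using hx i hi

theorem exists_nonneg_sum_smul_eq_of_forall_nonpos [Fintype ι] (f : ι → Dual 𝕜 V) (g : Dual 𝕜 V)
    (h : ∀ v, (∀ i, f i v ≤ 0) → g v ≤ 0) : ∃ c : ι → 𝕜, 0 ≤ c ∧ ∑ i, c i • f i = g := by
  have hg := mem_hull_image_of_forall_nonpos Finset.univ f g (by simpa using h)
  rw [Finset.coe_univ, Set.image_univ] at hg
  obtain ⟨c, hc⟩ := (Submodule.mem_span_range_iff_exists_fun _).1 hg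
  exact ⟨fun i => c i, fun i => (c i).2, hc⟩

end Farkas

section AbsolutelyContinuous

theorem absolutelyContinuousOnInterval_comp_of_locallyLipschitz {X Y : Type*}
    [SeminormedAddCommGroup X] [PseudoMetricSpace Y] {g : X → Y} (hg : LocallyLipschitz g)
    {f : ℝ → X} {a b : ℝ} (hf : AbsolutelyContinuousOnInterval f a b) :
    AbsolutelyContinuousOnInterval (g ∘ f) a b := by
  obtain ⟨K, hK⟩ := hg.locallyLipschitzOn.exists_lipschitzOnWith_of_compact
    ((isCompact_uIcc (a := a) (b := b)).image_of_continuousOn hf.continuousOn)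
  have hlim : Tendsto (fun I : ℕ × (ℕ → ℝ × ℝ) =>
      (K : ℝ) * ∑ i ∈ Finset.range I.1, dist (f (I.2 i).1) (f (I.2 i).2))
      (AbsolutelyContinuousOnInterval.totalLengthFilter ⊓
        𝓟 (AbsolutelyContinuousOnInterval.disjWithin a b)) (𝓝 0) := by
    simpa using Tendsto.const_mul (K : ℝ) hf
  refine squeeze_zero' (.of_forall fun I => Finset.sum_nonneg fun i _ => dist_nonneg) ?_ hlim
  filter_upwards [mem_inf_of_right (mem_principal_self _)] with I hI
  rw [Finset.mul_sum]
  refine Finset.sum_le_sum fun i hi => ?_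
  obtain ⟨h₁, h₂⟩ := hI.1 i hi
  exact hK.dist_le_mul _ (Set.mem_image_of_mem f h₁) _ (Set.mem_image_of_mem f h₂)

variable {E F : Type*} [NormedAddCommGroup E] [NormedSpace ℝ E] [NormedAddCommGroup F]
  [NormedSpace ℝ F]

/-- `f` is locally absolutely continuous on `[0, ∞)` with almost everywhere derivative `f'`: the
sense in which a Carathéodory solution `z` of `ż = Z z` satisfies its equation, with
`f' = fun t => Z (z t)`. -/
structure HasACDeriv (f f' : ℝ → E) : Prop where
  absCont : ∀ T, 0 < T → AbsolutelyContinuousOnInterval f 0 T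
  hasDerivAt : ∀ᵐ t : ℝ, 0 < t → HasDerivAt f (f' t) t

namespace HasACDeriv

theorem comp_locallyLipschitz {g : E → F} {f f' : ℝ → E} {h' : ℝ → F} (hf : HasACDeriv f f')
    (hg : LocallyLipschitz g) (hchain : ∀ t, HasDerivAt f (f' t) t → HasDerivAt (g ∘ f) (h' t) t) :
    HasACDeriv (g ∘ f) h' where
  absCont T hT := absolutelyContinuousOnInterval_comp_of_locallyLipschitz hg (hf.absCont T hT)
  hasDerivAt := hf.hasDerivAt.mono fun t h ht => hchain t (h ht)

theorem clm_comp {f f' : ℝ → E} (hf : HasACDeriv f f') (L : E →L[ℝ] F) :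
    HasACDeriv (fun t => L (f t)) (fun t => L (f' t)) :=
  hf.comp_locallyLipschitz L.lipschitz.locallyLipschitz
    fun t ht => L.hasFDerivAt.comp_hasDerivAt t ht

variable {s t : ℝ}

section Real

variable {f f' : ℝ → ℝ}

theorem absolutelyContinuousOnInterval (hf : HasACDeriv f f') (hs : 0 ≤ s) (hst : s ≤ t) :
    AbsolutelyContinuousOnInterval f s t := by
  refine (hf.absCont (t + 1) (by linarith)).mono ?_
  rw [Set.uIcc_of_le hst, Set.uIcc_of_le (by linarith)]
  exact Set.Icc_subset_Icc hs (by linarith)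

theorem ae_deriv_eq (hf : HasACDeriv f f') (hs : 0 ≤ s) (hst : s ≤ t) :
    ∀ᵐ r, r ∈ Set.uIoc s t → deriv f r = f' r := by
  filter_upwards [hf.hasDerivAt] with r hr hmem
  rw [Set.uIoc_of_le hst] at hmem
  exact (hr (hs.trans_lt hmem.1)).deriv

theorem intervalIntegrable (hf : HasACDeriv f f') (hs : 0 ≤ s) (hst : s ≤ t) :
    IntervalIntegrable f' volume s t :=
  (hf.absolutelyContinuousOnInterval hs hst).intervalIntegrable_deriv.congr_ae
    ((ae_restrict_iff' measurableSet_uIoc).2 (hf.ae_deriv_eq hs hst))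

theorem integral_eq_sub (hf : HasACDeriv f f') (hs : 0 ≤ s) (hst : s ≤ t) :
    ∫ r in s..t, f' r = f t - f s := by
  rw [← (hf.absolutelyContinuousOnInterval hs hst).integral_deriv_eq_sub]
  exact (intervalIntegral.integral_congr_ae (hf.ae_deriv_eq hs hst)).symm

theorem antitoneOn (hf : HasACDeriv f f') (hf' : ∀ᵐ t, 0 < t → f' t ≤ 0) :
    AntitoneOn f (Set.Ici 0) := fun s hs t _ hst => by
  have h : ∫ r in s..t, f' r ≤ ∫ _ in s..t, (0 : ℝ) := by
    refine intervalIntegral.integral_mono_ae_restrict hst (hf.intervalIntegrable hs hst)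
      (by simp) ?_
    filter_upwards [ae_restrict_of_ae hf', ae_restrict_of_ae (volume.ae_ne 0),
      ae_restrict_mem measurableSet_Icc] with r hr h0 hmem
    exact hr ((le_trans hs hmem.1).lt_of_ne' h0)
  rw [hf.integral_eq_sub hs hst, intervalIntegral.integral_zero] at h
  linarith

end Real

theorem norm_sub_le {f f' : ℝ → E} {C : ℝ} (hf : HasACDeriv f f') (hC : ∀ t, 0 < t → ‖f' t‖ ≤ C)
    (hs : 0 ≤ s) (hst : s ≤ t) : ‖f t - f s‖ ≤ C * (t - s) := by
  have hC₀ : 0 ≤ C := (norm_nonneg _).trans (hC 1 one_pos)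
  refine NormedSpace.norm_le_dual_bound ℝ _ (mul_nonneg hC₀ (sub_nonneg.2 hst)) fun L => ?_
  rw [map_sub, ← (hf.clm_comp L).integral_eq_sub hs hst]
  refine (intervalIntegral.norm_integral_le_of_norm_le_const (C := ‖L‖ * C) fun r hr => ?_).trans_eq
    (by rw [abs_of_nonneg (sub_nonneg.2 hst)]; ring)
  rw [Set.uIoc_of_le hst] at hr
  exact (L.le_opNorm _).trans (by gcongr; exact hC r (hs.trans_lt hr.1))

end HasACDeriv

theorem hasACDeriv_equiv_comp_iff (L : E ≃L[ℝ] F) {f f' : ℝ → E} :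
    HasACDeriv (fun t => L (f t)) (fun t => L (f' t)) ↔ HasACDeriv f f' :=
  ⟨fun h => by simpa using h.clm_comp (L.symm : F →L[ℝ] E), fun h => h.clm_comp (L : E →L[ℝ] F)⟩

/-- **Barbalat's lemma**, with the increments of `f` only required to dominate the integrals of `g`,
so that `g` need not be the derivative of `f`. -/
theorem tendsto_zero_of_abs_integral_le_abs_sub {f g : ℝ → ℝ} {l : ℝ}
    (hf : Tendsto f atTop (𝓝 l)) (hg : UniformContinuousOn g (Set.Ici 0))
    (h : ∀ s t, 0 ≤ s → s ≤ t → |∫ r in s..t, g r| ≤ |f t - f s|) :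
    Tendsto g atTop (𝓝 0) := by
  rw [Metric.tendsto_nhds]
  intro ε hε
  obtain ⟨η, hη, hgη⟩ := Metric.uniformContinuousOn_iff_le.1 hg (ε / 2) (by linarith)
  have hdiff : Tendsto (fun t => |f (t + η) - f t|) atTop (𝓝 0) := by
    simpa using ((hf.comp (tendsto_atTop_add_const_right _ η tendsto_id)).sub hf).abs
  filter_upwards [hdiff.eventually_lt_const (show 0 < η * (ε / 2) by positivity),
    eventually_ge_atTop 0] with t ht ht0
  have hint : IntervalIntegrable g volume t (t + η) := by
    refine (hg.continuousOn.mono ?_).intervalIntegrable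
    rw [Set.uIcc_of_le (by linarith)]
    exact fun x hx => ht0.trans hx.1
  have hosc : |(∫ x in t..(t + η), g x) - η * g t| ≤ ε / 2 * η := by
    have heq : (∫ x in t..(t + η), g x) - η * g t = ∫ x in t..(t + η), (g x - g t) := by
      simp [intervalIntegral.integral_sub hint]
    rw [heq, ← Real.norm_eq_abs]
    refine (intervalIntegral.norm_integral_le_of_norm_le_const (C := ε / 2) fun x hx => ?_).trans_eq
      (by rw [add_sub_cancel_left, abs_of_pos hη])
    rw [Set.uIoc_of_le (by linarith)] at hx
    refine hgη x (ht0.trans hx.1.le) t ht0 ?_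
    rw [Real.dist_eq, abs_of_nonneg (by linarith [hx.1])]
    linarith [hx.2]
  have hη_mul : η * |g t| < η * ε := by
    calc η * |g t| = |(∫ x in t..(t + η), g x) - ((∫ x in t..(t + η), g x) - η * g t)| := by
          rw [sub_sub_cancel, abs_mul, abs_of_pos hη]
      _ ≤ |f (t + η) - f t| + ε / 2 * η :=
          (abs_sub _ _).trans (add_le_add (h t _ ht0 (by linarith)) hosc)
      _ < η * ε := by linarith
  rw [Real.dist_eq, sub_zero]
  exact lt_of_mul_lt_mul_left hη_mul hη.le

end AbsolutelyContinuous

theorem exists_tendsto_atTop_of_antitoneOn {f : ℝ → ℝ} {a b : ℝ} (hf : AntitoneOn f (Set.Ici a))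
    (hb : ∀ t, b ≤ f t) : ∃ l, Tendsto f atTop (𝓝 l) := by
  have hanti : Antitone fun t => f (max t a) := fun s t hst =>
    hf (le_max_right s a) (le_max_right t a) (max_le_max_right a hst)
  refine ⟨_, (tendsto_atTop_ciInf hanti ⟨b, Set.forall_mem_range.2 fun t => hb _⟩).congr' ?_⟩
  filter_upwards [eventually_ge_atTop a] with t ht
  rw [max_eq_left ht]

theorem eq_of_mapClusterPt_of_tendsto {X Y α : Type*} [TopologicalSpace X] [TopologicalSpace Y]
    [T2Space Y] {l : Filter α} {z : α → X} {g : X → Y} {b : X} {c : Y} (hb : MapClusterPt b l z)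
    (hg : ContinuousAt g b) (h : Tendsto (g ∘ z) l (𝓝 c)) : g b = c :=
  eq_of_nhds_neBot (ClusterPt.mono (hb.continuousAt_comp hg) h)

section Convexity

variable {E : Type*} [NormedAddCommGroup E] [NormedSpace ℝ E]

theorem fderiv_sub_le_sub_of_convexOn {f : E → ℝ} (hf : ConvexOn ℝ Set.univ f) {x : E}
    (hx : DifferentiableAt ℝ f x) (y : E) : fderiv ℝ f x (y - x) ≤ f y - f x := by
  have hline : ConvexOn ℝ Set.univ (f ∘ AffineMap.lineMap (k := ℝ) x y) :=
    hf.comp_affineMap (AffineMap.lineMap x y)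
  have hderiv : HasDerivAt (f ∘ AffineMap.lineMap (k := ℝ) x y) (fderiv ℝ f x (y - x)) 0 :=
    HasFDerivAt.comp_hasDerivAt (0 : ℝ) (by simpa using hx.hasFDerivAt) AffineMap.hasDerivAt_lineMap
  simpa [slope_def_field] using
    hline.le_slope_of_hasDerivAt (Set.mem_univ 0) (Set.mem_univ 1) one_pos hderiv

theorem isMinOn_univ_of_convexOn_of_fderiv_eq_zero {f : E → ℝ} (hf : ConvexOn ℝ Set.univ f) {x : E}
    (hx : DifferentiableAt ℝ f x) (h : fderiv ℝ f x = 0) : IsMinOn f Set.univ x := fun y _ => by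
  have := fderiv_sub_le_sub_of_convexOn hf hx y
  simpa [h] using this

end Convexity

section LeastSquares

variable {E F : Type*} [NormedAddCommGroup F] [InnerProductSpace ℝ F]

theorem strictConvexOn_norm_sq : StrictConvexOn ℝ Set.univ fun x : F => ‖x‖ ^ 2 := by
  refine StrongConvexOn.strictConvexOn (m := 2) (strongConvexOn_iff_convex.2 ?_) two_pos
  simpa using convexOn_const (0 : ℝ) (convex_univ (𝕜 := ℝ) (E := F))

theorem strictConvexOn_norm_map_sub_sq [AddCommGroup E] [Module ℝ E] {L : E →ₗ[ℝ] F}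
    (hL : Function.Injective L) (b : F) : StrictConvexOn ℝ Set.univ fun x => ‖L x - b‖ ^ 2 := by
  refine ⟨convex_univ, fun x _ y _ hxy r s hr hs hrs => ?_⟩
  have hmap : L (r • x + s • y) - b = r • (L x - b) + s • (L y - b) := by
    rw [smul_sub, smul_sub, sub_add_sub_comm, ← add_smul, hrs, one_smul, map_add, map_smul,
      map_smul]
  dsimp only
  rw [hmap]
  exact strictConvexOn_norm_sq.2 (Set.mem_univ _) (Set.mem_univ _)
    (sub_left_injective.ne (hL.ne hxy)) hr hs hrs

end LeastSquares

theorem hasGradientAt_const_add_sum_mul {κ : Type*} [Fintype κ] (a : ℝ) (b : κ → ℝ)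
    (y : EuclideanSpace ℝ κ) :
    HasGradientAt (fun y : EuclideanSpace ℝ κ => a + ∑ j, y j * b j) (WithLp.toLp 2 b) y := by
  rw [hasGradientAt_iff_hasFDerivAt]
  refine ((InnerProductSpace.toDual ℝ (EuclideanSpace ℝ κ)
    (WithLp.toLp 2 b)).hasFDerivAt.const_add a).congr_of_eventuallyEq (.of_forall fun y => ?_)
  simp [PiLp.inner_apply]

section SquaredDistance

variable {E ι : Type*} [NormedAddCommGroup E] [Fintype ι]

/-- The squared Euclidean distance between `w'` and `w` (the norm of `E × (ι → ℝ)` being the maximum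
of the norms of the components). -/
def sqDist (w' w : E × (ι → ℝ)) : ℝ := ‖w.1 - w'.1‖ ^ 2 + ∑ j, (w.2 j - w'.2 j) ^ 2

theorem sqDist_self (w : E × (ι → ℝ)) : sqDist w w = 0 := by simp [sqDist]

theorem sqDist_nonneg (w' w : E × (ι → ℝ)) : 0 ≤ sqDist w' w :=
  add_nonneg (sq_nonneg _) (Finset.sum_nonneg fun _ _ => sq_nonneg _)

theorem norm_sub_le_sqrt_sqDist (w' w : E × (ι → ℝ)) : ‖w - w'‖ ≤ √(sqDist w' w) := by
  have hsum : 0 ≤ ∑ j, (w.2 j - w'.2 j) ^ 2 := Finset.sum_nonneg fun j _ => sq_nonneg _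
  refine max_le ?_ ((pi_norm_le_iff_of_nonneg (Real.sqrt_nonneg _)).2 fun j => ?_)
  · exact Real.le_sqrt_of_sq_le (le_add_of_nonneg_right hsum)
  · exact Real.abs_le_sqrt ((Finset.single_le_sum (f := fun j => (w.2 j - w'.2 j) ^ 2)
      (fun j _ => sq_nonneg _) (Finset.mem_univ j)).trans (le_add_of_nonneg_left (sq_nonneg _)))

variable [InnerProductSpace ℝ E]

/-- The Euclidean inner product of `w - w'` and `v`. -/
def innerSub (w' w v : E × (ι → ℝ)) : ℝ :=
  inner ℝ (w.1 - w'.1) v.1 + ∑ j, (w.2 j - w'.2 j) * v.2 j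

theorem innerSub_smul (w' w v : E × (ι → ℝ)) (c : ℝ) :
    innerSub w' w (c • v) = c * innerSub w' w v := by
  simp only [innerSub, Prod.smul_fst, Prod.smul_snd, Pi.smul_apply, smul_eq_mul, inner_smul_right,
    mul_left_comm _ c, ← Finset.mul_sum, mul_add]

theorem contDiff_sqDist (w' : E × (ι → ℝ)) : ContDiff ℝ 1 (sqDist w') :=
  ((contDiff_fst.sub contDiff_const).norm_sq ℝ).add <| ContDiff.sum fun j _ =>
    (((contDiff_apply ℝ ℝ j).comp contDiff_snd).sub contDiff_const).pow 2

theorem hasDerivAt_sqDist {z : ℝ → E × (ι → ℝ)} {v : E × (ι → ℝ)} {t : ℝ}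
    (hz : HasDerivAt z v t) (w' : E × (ι → ℝ)) :
    HasDerivAt (sqDist w' ∘ z) (2 * innerSub w' (z t) v) t := by
  have hfst : HasDerivAt (fun s => (z s).1 - w'.1) v.1 t :=
    ((ContinuousLinearMap.fst ℝ E (ι → ℝ)).hasFDerivAt.comp_hasDerivAt t hz).sub_const _
  have hsnd (j : ι) : HasDerivAt (fun s => (z s).2 j - w'.2 j) (v.2 j) t :=
    (hasDerivAt_pi.1 ((ContinuousLinearMap.snd ℝ E (ι → ℝ)).hasFDerivAt.comp_hasDerivAt t hz)
      j).sub_const _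
  refine (hfst.norm_sq.add (HasDerivAt.fun_sum fun j _ => (hsnd j).pow 2)).congr_deriv ?_
  simp [innerSub, mul_add, Finset.mul_sum, mul_assoc]

theorem hasACDeriv_sqDist {z z' : ℝ → E × (ι → ℝ)} (hz : HasACDeriv z z') (w' : E × (ι → ℝ)) :
    HasACDeriv (sqDist w' ∘ z) fun t => 2 * innerSub w' (z t) (z' t) :=
  hz.comp_locallyLipschitz (contDiff_sqDist w').locallyLipschitz fun _ ht => hasDerivAt_sqDist ht w'

end SquaredDistance

section Regulator

/-- The regulator of the Skorokhod problem on the half line: the least nondecreasing nonnegative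
function that keeps `X + regulator X` nonnegative on `[0, ∞)`. It vanishes at negative times, where
the supremum is that of the empty set. -/
def regulator (X : ℝ → ℝ) (t : ℝ) : ℝ :=
  sSup ((fun s => (X s)⁻) '' Set.Icc 0 t)

variable {X Y : ℝ → ℝ} {s t c : ℝ}

theorem regulator_nonneg : 0 ≤ regulator X t :=
  Real.sSup_nonneg (by rintro _ ⟨s, -, rfl⟩; exact negPart_nonneg _)

theorem regulator_zero (hX : 0 ≤ X 0) : regulator X 0 = 0 := by
  simp [regulator, negPart_eq_zero.2 hX]

theorem isGreatest_regulator (hX : Continuous X) (ht : 0 ≤ t) :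
    IsGreatest ((fun s => (X s)⁻) '' Set.Icc 0 t) (regulator X t) :=
  (isCompact_Icc.image (by fun_prop)).isGreatest_sSup ((Set.nonempty_Icc.2 ht).image _)

theorem negPart_le_regulator (hX : Continuous X) (hs : 0 ≤ s) (hst : s ≤ t) :
    (X s)⁻ ≤ regulator X t :=
  (isGreatest_regulator hX (hs.trans hst)).2 ⟨s, ⟨hs, hst⟩, rfl⟩

theorem regulator_le_iff (hX : Continuous X) (ht : 0 ≤ t) :
    regulator X t ≤ c ↔ ∀ s ∈ Set.Icc 0 t, (X s)⁻ ≤ c :=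
  (isLUB_le_iff (isGreatest_regulator hX ht).isLUB).trans Set.forall_mem_image

theorem add_regulator_nonneg (hX : Continuous X) (ht : 0 ≤ t) : 0 ≤ X t + regulator X t := by
  linarith [neg_le_negPart (X t), negPart_le_regulator hX ht le_rfl]

theorem monotone_regulator (hX : Continuous X) : Monotone (regulator X) := fun s t hst => by
  rcases lt_or_ge s 0 with hs | hs
  · simpa [regulator, Set.Icc_eq_empty hs.not_ge] using regulator_nonneg (X := X) (t := t)
  · exact (regulator_le_iff hX hs).2 fun r hr => negPart_le_regulator hX hr.1 (hr.2.trans hst)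

theorem negPart_le_negPart_add_abs_sub (x y : ℝ) : x⁻ ≤ y⁻ + |x - y| := by
  rw [negPart_def, sup_le_iff]
  constructor
  · linarith [neg_le_negPart y, neg_abs_le (x - y)]
  · exact add_nonneg (negPart_nonneg y) (abs_nonneg _)

theorem regulator_le_regulator_add (hX : Continuous X) (hY : Continuous Y) (ht : 0 ≤ t)
    (h : ∀ s ∈ Set.Icc 0 t, |X s - Y s| ≤ c) : regulator X t ≤ regulator Y t + c :=
  (regulator_le_iff hX ht).2 fun s hs => (negPart_le_negPart_add_abs_sub (X s) (Y s)).trans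
    (add_le_add (negPart_le_regulator hY hs.1 hs.2) (h s hs))

theorem abs_regulator_sub_le (hX : Continuous X) (hY : Continuous Y) (ht : 0 ≤ t)
    (h : ∀ s ∈ Set.Icc 0 t, |X s - Y s| ≤ c) : |regulator X t - regulator Y t| ≤ c :=
  abs_sub_le_iff.2 ⟨sub_le_iff_le_add'.2 (regulator_le_regulator_add hX hY ht h),
    sub_le_iff_le_add'.2
      (regulator_le_regulator_add hY hX ht fun s hs => abs_sub_comm (X s) (Y s) ▸ h s hs)⟩

theorem continuousOn_regulator (hX : Continuous X) : ContinuousOn (regulator X) (Set.Ici 0) := by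
  have h : Continuous fun t => sSup ((fun r => (X (r * t))⁻) '' Set.Icc 0 1) :=
    isCompact_Icc.continuous_sSup (by fun_prop)
  refine h.continuousOn.congr fun t ht => ?_
  have himage : (fun r => r * t) '' Set.Icc 0 1 = Set.Icc 0 t := by
    rw [Set.image_mul_right_Icc zero_le_one ht, zero_mul, one_mul]
  rw [regulator, ← himage, Set.image_image]

theorem lipschitzOnWith_regulator {K : NNReal} (hX : Continuous X)
    (hK : LipschitzOnWith K X (Set.Ici 0)) : LipschitzOnWith K (regulator X) (Set.Ici 0) := by
  refine LipschitzOnWith.of_le_add_mul K fun t ht s hs => ?_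
  rcases le_total t s with hts | hst
  · exact (monotone_regulator hX hts).trans (le_add_of_nonneg_right (by positivity))
  refine (regulator_le_iff hX ht).2 fun r hr => ?_
  rcases le_total r s with hrs | hsr
  · exact (negPart_le_regulator hX hr.1 hrs).trans (le_add_of_nonneg_right (by positivity))
  refine (negPart_le_negPart_add_abs_sub (X r) (X s)).trans
    (add_le_add (negPart_le_regulator hX hs le_rfl) ((hK.dist_le_mul r hr.1 s hs).trans ?_))
  gcongr
  rw [Real.dist_eq, Real.dist_eq, abs_of_nonneg (by linarith), abs_of_nonneg (by linarith)]
  linarith [hr.2]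

theorem regulator_eventuallyEq_of_pos (hX : Continuous X) (ht : 0 ≤ t)
    (hpos : 0 < X t + regulator X t) : regulator X =ᶠ[𝓝[≥] t] fun _ => regulator X t := by
  obtain ⟨u, htu, hu⟩ := mem_nhdsGE_iff_exists_Icc_subset.1 (nhdsWithin_le_nhds
    ((hX.add_const (regulator X t)).continuousAt.eventually_const_lt hpos))
  filter_upwards [Icc_mem_nhdsGE htu] with s hs
  refine le_antisymm ((regulator_le_iff hX (ht.trans hs.1)).2 fun r hr => ?_)
    (monotone_regulator hX hs.1)
  rcases le_total r t with hrt | htr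
  · exact negPart_le_regulator hX hr.1 hrt
  · have hr_pos : 0 < X r + regulator X t := hu ⟨htr, hr.2.trans hs.2⟩
    exact max_le (by linarith) regulator_nonneg

theorem hasDerivAt_add_regulator {v : ℝ} (hX : Continuous X) (ht : 0 < t)
    (hv : HasDerivAt X v t) (hreg : DifferentiableAt ℝ (regulator X) t) :
    HasDerivAt (fun s => X s + regulator X s) (projPlus v (X t + regulator X t)) t := by
  convert! hv.add hreg.hasDerivAt using 1
  rcases (add_regulator_nonneg hX ht.le).lt_or_eq with hpos | hzero
  · have hright : HasDerivWithinAt (regulator X) 0 (Set.Ici t) t :=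
      (hasDerivWithinAt_const t _ _).congr_of_eventuallyEq_of_mem
        (regulator_eventuallyEq_of_pos hX ht.le hpos) Set.self_mem_Ici
    rw [projPlus, if_pos hpos, (uniqueDiffWithinAt_Ici t).eq_deriv _
      hreg.hasDerivAt.hasDerivWithinAt hright, add_zero]
  · have hmin : IsLocalMin (fun s => X s + regulator X s) t := by
      filter_upwards [Ioi_mem_nhds ht] with s hs
      exact hzero ▸ add_regulator_nonneg hX (le_of_lt hs)
    have hderiv := hmin.hasDerivAt_eq_zero (hv.add hreg.hasDerivAt)
    have hmono : 0 ≤ deriv (regulator X) t := (monotone_regulator hX).deriv_nonneg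
    rw [hderiv, projPlus, if_neg hzero.not_lt, max_eq_right (by linarith)]

end Regulator

section FunctionalODE

open BoundedContinuousFunction

variable {V : Type*} [NormedAddCommGroup V] [NormedSpace ℝ V]

/-- `Φ` is a bounded causal functional on continuous paths: the value `Φ X t` depends only on `X` on
`[0, t]`, and is a Lipschitz function of it in the supremum norm. -/
structure IsCausalLipschitz (Φ : (ℝ → V) → ℝ → V) (K M : ℝ) : Prop where
  nonneg : 0 ≤ K
  continuousOn : ∀ {X}, Continuous X → ContinuousOn (Φ X) (Set.Ici 0)
  norm_le : ∀ X t, ‖Φ X t‖ ≤ M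
  norm_sub_le : ∀ {X Y t c}, Continuous X → Continuous Y → 0 ≤ t →
    (∀ s ∈ Set.Icc 0 t, ‖X s - Y s‖ ≤ c) → ‖Φ X t - Φ Y t‖ ≤ K * c

/-- The path that starts at `x₀` with velocity `exp (α s) • w s`. The exponential weight makes the
integral operator a contraction in the supremum norm of `w` on the whole half line. -/
def weightedPath (α : ℝ) (x₀ : V) (w : ℝ →ᵇ V) (t : ℝ) : V :=
  x₀ + ∫ s in (0)..t, Real.exp (α * s) • w s

variable {α : ℝ} {x₀ : V}

theorem norm_weightedPath_sub_le (hα : 0 < α) (w w' : ℝ →ᵇ V) {s t : ℝ} (hs : 0 ≤ s) (hst : s ≤ t) :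
    ‖weightedPath α x₀ w s - weightedPath α x₀ w' s‖ ≤ Real.exp (α * t) / α * dist w w' := by
  have hint (u : ℝ →ᵇ V) :
      IntervalIntegrable (fun r => Real.exp (α * r) • u r) volume 0 s :=
    Continuous.intervalIntegrable (by fun_prop) _ _
  have hexp : ∫ r in (0)..s, Real.exp (α * r) = (Real.exp (α * s) - 1) / α := by
    rw [intervalIntegral.integral_comp_mul_left Real.exp hα.ne']
    simp [integral_exp, div_eq_inv_mul]
  rw [weightedPath, weightedPath, add_sub_add_left_eq_sub,
    ← intervalIntegral.integral_sub (hint w) (hint w')]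
  calc _ ≤ ∫ r in (0)..s, Real.exp (α * r) * dist w w' := by
        refine intervalIntegral.norm_integral_le_of_norm_le hs (ae_of_all _ fun r _ => ?_)
          (Continuous.intervalIntegrable (by fun_prop) _ _)
        rw [← smul_sub, norm_smul, Real.norm_eq_abs, Real.abs_exp, ← dist_eq_norm]
        gcongr
        exact dist_coe_le_dist r
    _ = (Real.exp (α * s) - 1) / α * dist w w' := by
        rw [intervalIntegral.integral_mul_const, hexp]
    _ ≤ Real.exp (α * t) / α * dist w w' := by
        gcongr
        exact (sub_le_self _ zero_le_one).trans (by gcongr)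

variable [CompleteSpace V]

theorem hasDerivAt_weightedPath (w : ℝ →ᵇ V) (t : ℝ) :
    HasDerivAt (weightedPath α x₀ w) (Real.exp (α * t) • w t) t :=
  (intervalIntegral.integral_hasDerivAt_right (Continuous.intervalIntegrable (by fun_prop) _ _)
    (Continuous.stronglyMeasurableAtFilter (by fun_prop) _ _) (by fun_prop)).const_add x₀

theorem continuous_weightedPath (w : ℝ →ᵇ V) : Continuous (weightedPath α x₀ w) :=
  continuous_iff_continuousAt.2 fun t => (hasDerivAt_weightedPath w t).continuousAt

namespace IsCausalLipschitz

variable {Φ : (ℝ → V) → ℝ → V} {K M : ℝ}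

/-- The weighted velocity of `X' = Φ X`, as a function of the weighted velocity of `X`. -/
def picard (hΦ : IsCausalLipschitz Φ K M) (hα : 0 < α) (x₀ : V) (w : ℝ →ᵇ V) : ℝ →ᵇ V :=
  .ofNormedAddCommGroup
    (fun t => Real.exp (-(α * max t 0)) • Φ (weightedPath α x₀ w) (max t 0))
    (.smul (by fun_prop) ((hΦ.continuousOn (continuous_weightedPath w)).comp_continuous
      (by fun_prop) fun t => le_max_right t 0)) M fun t => by
    rw [norm_smul, Real.norm_eq_abs, Real.abs_exp]
    refine (mul_le_of_le_one_left (norm_nonneg _) (Real.exp_le_one_iff.2 ?_)).trans (hΦ.norm_le _ _)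
    exact neg_nonpos.2 (mul_nonneg hα.le (le_max_right t 0))

theorem picard_apply (hΦ : IsCausalLipschitz Φ K M) (hα : 0 < α) (w : ℝ →ᵇ V) (t : ℝ) :
    hΦ.picard hα x₀ w t =
      Real.exp (-(α * max t 0)) • Φ (weightedPath α x₀ w) (max t 0) :=
  rfl

theorem contractingWith_picard (hΦ : IsCausalLipschitz Φ K M) (hα : 0 < α) (hK : 2 * K ≤ α) :
    ContractingWith 2⁻¹ (hΦ.picard hα x₀) := by
  refine ⟨by norm_num, LipschitzWith.of_dist_le_mul fun w w' => ?_⟩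
  refine (BoundedContinuousFunction.dist_le (by positivity)).2 fun t => ?_
  have hτ : 0 ≤ max t 0 := le_max_right t 0
  rw [picard_apply, picard_apply]
  set τ := max t 0
  rw [dist_smul₀, Real.norm_eq_abs, Real.abs_exp, dist_eq_norm]
  calc _ ≤ Real.exp (-(α * τ)) * (K * (Real.exp (α * τ) / α * dist w w')) := by
        gcongr
        exact hΦ.norm_sub_le (continuous_weightedPath w) (continuous_weightedPath w') hτ
          fun s hs => norm_weightedPath_sub_le hα w w' hs.1 hs.2
    _ = K / α * dist w w' := by
        rw [Real.exp_neg]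
        field_simp
    _ ≤ ((2⁻¹ : NNReal) : ℝ) * dist w w' := by
        gcongr
        rw [div_le_iff₀ hα, NNReal.coe_inv, NNReal.coe_ofNat]
        linarith

theorem exists_hasDerivAt (hΦ : IsCausalLipschitz Φ K M) (x₀ : V) :
    ∃ X : ℝ → V, Continuous X ∧ X 0 = x₀ ∧ ∀ t, 0 ≤ t → HasDerivAt X (Φ X t) t := by
  have hα : 0 < 2 * K + 1 := by linarith [hΦ.nonneg]
  have hcontr := hΦ.contractingWith_picard (x₀ := x₀) hα (by linarith)
  obtain ⟨w, hw, -⟩ := hcontr.exists_fixedPoint 0 (edist_ne_top _ _)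
  refine ⟨weightedPath (2 * K + 1) x₀ w, continuous_weightedPath w, by simp [weightedPath],
    fun t ht => ?_⟩
  convert! hasDerivAt_weightedPath w t using 1
  have hwt : hΦ.picard hα x₀ w t = w t := DFunLike.congr_fun hw t
  rw [← hwt, picard_apply, max_eq_left ht, smul_smul, ← Real.exp_add, add_neg_cancel, Real.exp_zero,
    one_smul]

end IsCausalLipschitz

end FunctionalODE

section Reflection

variable {E ι : Type*}

/-- The vector field `F` on pairs of a point and a vector of multipliers, with the components of the
multipliers replaced by `[·]⁺`. -/
def projectedField (F : E × (ι → ℝ) → E × (ι → ℝ)) (w : E × (ι → ℝ)) : E × (ι → ℝ) :=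
  ((F w).1, fun j => projPlus ((F w).2 j) (w.2 j))

/-- The path `X` with its multipliers reflected at zero. -/
def reflect (X : ℝ → E × (ι → ℝ)) (t : ℝ) : E × (ι → ℝ) :=
  ((X t).1, fun j => (X t).2 j + regulator (fun s => (X s).2 j) t)

variable {X Y : ℝ → E × (ι → ℝ)}

theorem reflect_zero (hX : 0 ≤ (X 0).2) : reflect X 0 = X 0 :=
  Prod.ext rfl (funext fun j => by
    simp only [reflect, regulator_zero (X := fun s => (X s).2 j) (hX j), add_zero])

variable [NormedAddCommGroup E]

theorem continuous_multiplier (hX : Continuous X) (j : ι) : Continuous fun s => (X s).2 j := by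
  fun_prop

theorem reflect_nonneg (hX : Continuous X) {t : ℝ} (ht : 0 ≤ t) : 0 ≤ (reflect X t).2 :=
  fun j => add_regulator_nonneg (continuous_multiplier hX j) ht

theorem continuousOn_reflect (hX : Continuous X) : ContinuousOn (reflect X) (Set.Ici 0) :=
  hX.fst.continuousOn.prodMk <| continuousOn_pi.2 fun j =>
    (continuous_multiplier hX j).continuousOn.add
      (continuousOn_regulator (continuous_multiplier hX j))

theorem ae_hasDerivAt_reflect [NormedSpace ℝ E] [Finite ι] {v : ℝ → E × (ι → ℝ)}
    (hX : Continuous X) (hv : ∀ t, 0 < t → HasDerivAt X (v t) t) :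
    ∀ᵐ t : ℝ, 0 < t → HasDerivAt (reflect X)
      ((v t).1, fun j => projPlus ((v t).2 j) ((reflect X t).2 j)) t := by
  have := Fintype.ofFinite ι
  have hreg : ∀ᵐ t : ℝ, ∀ j, DifferentiableAt ℝ (regulator fun s => (X s).2 j) t :=
    ae_all_iff.2 fun j => (monotone_regulator (continuous_multiplier hX j)).ae_differentiableAt
  filter_upwards [hreg] with t hreg_t ht
  have hfst : HasDerivAt (fun s => (X s).1) (v t).1 t :=
    (ContinuousLinearMap.fst ℝ E (ι → ℝ)).hasFDerivAt.comp_hasDerivAt t (hv t ht)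
  have hsnd : HasDerivAt (fun s => (X s).2) (v t).2 t :=
    (ContinuousLinearMap.snd ℝ E (ι → ℝ)).hasFDerivAt.comp_hasDerivAt t (hv t ht)
  exact hfst.prodMk (hasDerivAt_pi.2 fun j => hasDerivAt_add_regulator
    (continuous_multiplier hX j) ht (hasDerivAt_pi.1 hsnd j) (hreg_t j))

variable [Fintype ι]

theorem norm_reflect_sub_le (hX : Continuous X) (hY : Continuous Y) {t c : ℝ} (ht : 0 ≤ t)
    (h : ∀ s ∈ Set.Icc 0 t, ‖X s - Y s‖ ≤ c) : ‖reflect X t - reflect Y t‖ ≤ 2 * c := by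
  have hc : 0 ≤ c := (norm_nonneg _).trans (h t ⟨ht, le_rfl⟩)
  have hmult (j : ι) {s : ℝ} (hs : s ∈ Set.Icc 0 t) : |(X s).2 j - (Y s).2 j| ≤ c :=
    (norm_le_pi_norm ((X s).2 - (Y s).2) j).trans ((norm_snd_le (X s - Y s)).trans (h s hs))
  refine max_le ?_ ((pi_norm_le_iff_of_nonneg (by positivity)).2 fun j => ?_)
  · have hfst : ‖(X t).1 - (Y t).1‖ ≤ c := (norm_fst_le (X t - Y t)).trans (h t ⟨ht, le_rfl⟩)
    exact hfst.trans (by linarith)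
  · have hreg := abs_regulator_sub_le (continuous_multiplier hX j) (continuous_multiplier hY j) ht
      fun s hs => hmult j hs
    change |(X t).2 j + _ - ((Y t).2 j + _)| ≤ 2 * c
    rw [add_sub_add_comm, two_mul]
    exact (abs_add_le _ _).trans (add_le_add (hmult j ⟨ht, le_rfl⟩) hreg)

theorem lipschitzOnWith_reflect {K : NNReal} (hX : Continuous X)
    (hK : LipschitzOnWith K X (Set.Ici 0)) :
    LipschitzOnWith (K + K) (reflect X) (Set.Ici 0) := by
  have hmult (j : ι) : LipschitzOnWith K (fun s => (X s).2 j) (Set.Ici 0) := by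
    have := ((LipschitzWith.eval j).comp LipschitzWith.prod_snd).comp_lipschitzOnWith hK
    rwa [one_mul, one_mul] at this
  refine LipschitzOnWith.of_dist_le_mul fun s hs t ht =>
    max_le ?_ ((dist_pi_le_iff (by positivity)).2 fun j => ?_)
  · calc dist (X s).1 (X t).1 ≤ K * dist s t := (le_max_left _ _).trans (hK.dist_le_mul s hs t ht)
      _ ≤ (K + K : NNReal) * dist s t := by gcongr; exact le_self_add
  · rw [NNReal.coe_add, add_mul]
    exact (dist_add_add_le _ _ _ _).trans (add_le_add ((hmult j).dist_le_mul s hs t ht)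
      ((lipschitzOnWith_regulator (continuous_multiplier hX j) (hmult j)).dist_le_mul s hs t ht))

theorem exists_hasACDeriv_projectedField [NormedSpace ℝ E] [CompleteSpace E]
    {F : E × (ι → ℝ) → E × (ι → ℝ)}
    {K : NNReal} {M : ℝ} (hF : LipschitzWith K F) (hM : ∀ w, ‖F w‖ ≤ M) {z₀ : E × (ι → ℝ)}
    (hz₀ : 0 ≤ z₀.2) :
    ∃ z : ℝ → E × (ι → ℝ), z 0 = z₀ ∧ (∀ t, 0 ≤ t → 0 ≤ (z t).2) ∧
      HasACDeriv z fun t => projectedField F (z t) := by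
  have hΦ : IsCausalLipschitz (fun X t => F (reflect X t)) (K * 2) M :=
    { nonneg := by positivity
      continuousOn := fun hX => hF.continuous.comp_continuousOn (continuousOn_reflect hX)
      norm_le := fun X t => hM _
      norm_sub_le := fun hX hY ht h => by
        rw [mul_assoc]
        exact (hF.norm_sub_le _ _).trans (by gcongr; exact norm_reflect_sub_le hX hY ht h) }
  obtain ⟨X, hX, rfl, hderiv⟩ := hΦ.exists_hasDerivAt z₀
  have hlip : LipschitzOnWith M.toNNReal X (Set.Ici 0) :=
    (convex_Ici 0).lipschitzOnWith_of_nnnorm_hasDerivWithin_le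
      (fun t ht => (hderiv t ht).hasDerivWithinAt)
      fun t _ => NNReal.le_toNNReal_of_coe_le (hM _)
  exact ⟨reflect X, reflect_zero hz₀, fun t ht => reflect_nonneg hX ht,
    { absCont := fun T hT => LipschitzOnWith.absolutelyContinuousOnInterval <|
        (lipschitzOnWith_reflect hX hlip).mono
          (by rw [Set.uIcc_of_le hT.le]; exact Set.Icc_subset_Ici_self)
      hasDerivAt := ae_hasDerivAt_reflect hX fun t ht => hderiv t ht.le }⟩

end Reflection

section ProjectedField

theorem sub_mul_projPlus_le {x y y' : ℝ} (hy : 0 ≤ y) (hy' : 0 ≤ y') :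
    (y - y') * projPlus x y ≤ (y - y') * x := by
  unfold projPlus
  split_ifs with h
  · exact le_rfl
  · obtain rfl : y = 0 := hy.antisymm' (not_lt.1 h)
    nlinarith [le_max_left x 0]

theorem projPlus_mul {c : ℝ} (hc : 0 ≤ c) (x y : ℝ) : projPlus (c * x) y = c * projPlus x y := by
  unfold projPlus
  split_ifs
  · rfl
  · rw [mul_max_of_nonneg _ _ hc, mul_zero]

theorem abs_projPlus_le (x y : ℝ) : |projPlus x y| ≤ |x| := by
  unfold projPlus
  split_ifs
  · exact le_rfl
  · rw [abs_of_nonneg (le_max_right _ _)]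
    exact max_le (le_abs_self x) (abs_nonneg x)

variable {E ι : Type*}

theorem norm_projectedField_le [Fintype ι] [NormedAddCommGroup E]
    (F : E × (ι → ℝ) → E × (ι → ℝ)) (w : E × (ι → ℝ)) :
    ‖projectedField F w‖ ≤ ‖F w‖ :=
  max_le (norm_fst_le (F w)) ((pi_norm_le_iff_of_nonneg (norm_nonneg _)).2 fun j =>
    (abs_projPlus_le _ _).trans ((norm_le_pi_norm (F w).2 j).trans (norm_snd_le _)))

theorem projectedField_smul [SMul ℝ E] {ρ : E × (ι → ℝ) → ℝ} (hρ : ∀ w, 0 ≤ ρ w)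
    (F : E × (ι → ℝ) → E × (ι → ℝ)) (w : E × (ι → ℝ)) :
    projectedField (fun w => ρ w • F w) w = ρ w • projectedField F w :=
  Prod.ext rfl (funext fun _ => projPlus_mul (hρ w) _ _)

end ProjectedField

/-- A convex program: the minimization of `obj` over the points `x` with `con j x ≤ 0` for all `j`.
The objective is strictly convex, which makes the minimizer unique, and the second derivatives serve
to make the saddle point dynamics locally Lipschitz. -/
structure ConvexProgram (E ι : Type*) [NormedAddCommGroup E] [NormedSpace ℝ E] where
  obj : E → ℝ
  con : ι → E → ℝ
  contDiff_obj : ContDiff ℝ 2 obj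
  contDiff_con : ∀ j, ContDiff ℝ 2 (con j)
  strictConvexOn_obj : StrictConvexOn ℝ Set.univ obj
  convexOn_con : ∀ j, ConvexOn ℝ Set.univ (con j)

namespace ConvexProgram

section Feasible

variable {E ι : Type*} [NormedAddCommGroup E] [NormedSpace ℝ E] (Q : ConvexProgram E ι)

/-- The points that satisfy all the constraints. -/
def feasible : Set E := {x | ∀ j, Q.con j x ≤ 0}

variable {Q}

theorem convex_feasible : Convex ℝ Q.feasible := by
  simp only [feasible, Set.ofPred_forall]
  exact convex_iInter fun j => by simpa using (Q.convexOn_con j).convex_le 0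

theorem eq_of_isMinOn_feasible {x x' : E} (hx : x ∈ Q.feasible) (hx' : x' ∈ Q.feasible)
    (hmin : IsMinOn Q.obj Q.feasible x) (hmin' : IsMinOn Q.obj Q.feasible x') : x = x' :=
  (Q.strictConvexOn_obj.subset (Set.subset_univ _) convex_feasible).eq_of_isMinOn hmin hmin' hx hx'

end Feasible

section SaddlePoint

variable {E ι : Type*} [NormedAddCommGroup E] [NormedSpace ℝ E] [Fintype ι]
  (Q : ConvexProgram E ι)

/-- The Lagrangian of the program, the multipliers being the first argument. -/
def lagrangian (y : ι → ℝ) (x : E) : ℝ := Q.obj x + ∑ j, y j * Q.con j x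

/-- `w = (x, y)` is a saddle point of the Lagrangian, minimal over all points and maximal over all
nonnegative multipliers. -/
structure IsSaddlePoint (w : E × (ι → ℝ)) : Prop where
  nonneg : 0 ≤ w.2
  le_self : ∀ y, 0 ≤ y → Q.lagrangian y w.1 ≤ Q.lagrangian w.2 w.1
  self_le : ∀ x, Q.lagrangian w.2 w.1 ≤ Q.lagrangian w.2 x

/-- The duality gap between the pairs `w' = (x', y')` and `w = (x, y)`. -/
def gap (w' w : E × (ι → ℝ)) : ℝ := Q.lagrangian w'.2 w.1 - Q.lagrangian w.2 w'.1

variable {Q} {w w' : E × (ι → ℝ)}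

theorem contDiff_lagrangian (y : ι → ℝ) : ContDiff ℝ 2 (Q.lagrangian y) :=
  Q.contDiff_obj.add (ContDiff.sum fun j _ => contDiff_const.mul (Q.contDiff_con j))

theorem differentiable_lagrangian (y : ι → ℝ) : Differentiable ℝ (Q.lagrangian y) :=
  (contDiff_lagrangian y).differentiable two_ne_zero

theorem continuous_lagrangian : Continuous fun w : E × (ι → ℝ) => Q.lagrangian w.2 w.1 :=
  (Q.contDiff_obj.continuous.comp continuous_fst).add <| continuous_finsetSum _ fun j _ =>
    ((continuous_apply j).comp continuous_snd).mul
      ((Q.contDiff_con j).continuous.comp continuous_fst)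

theorem continuous_gap (w' : E × (ι → ℝ)) : Continuous (Q.gap w') :=
  (contDiff_lagrangian w'.2).continuous.comp continuous_fst |>.sub <|
    continuous_lagrangian.comp (continuous_const.prodMk continuous_snd)

theorem strictConvexOn_lagrangian {y : ι → ℝ} (hy : 0 ≤ y) :
    StrictConvexOn ℝ Set.univ (Q.lagrangian y) := by
  have hsum : ConvexOn ℝ Set.univ (∑ j, fun x => y j * Q.con j x) :=
    Finset.sum_induction _ (ConvexOn ℝ Set.univ) (fun _ _ => ConvexOn.add)
      (convexOn_const 0 convex_univ) fun j _ => (Q.convexOn_con j).smul (hy j)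
  rw [Finset.sum_fn] at hsum
  exact Q.strictConvexOn_obj.add_convexOn hsum

theorem lagrangian_sub_lagrangian (y y' : ι → ℝ) (x : E) :
    Q.lagrangian y x - Q.lagrangian y' x = ∑ j, (y j - y' j) * Q.con j x := by
  simp only [lagrangian, add_sub_add_left_eq_sub, ← Finset.sum_sub_distrib, sub_mul]

namespace IsSaddlePoint

theorem excess_le_gap (hw' : Q.IsSaddlePoint w') (hw : 0 ≤ w.2) :
    Q.lagrangian w'.2 w.1 - Q.lagrangian w'.2 w'.1 ≤ Q.gap w' w :=
  sub_le_sub_left (hw'.le_self w.2 hw) _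

theorem gap_nonneg (hw' : Q.IsSaddlePoint w') (hw : 0 ≤ w.2) : 0 ≤ Q.gap w' w :=
  (sub_nonneg.2 (hw'.self_le w.1)).trans (hw'.excess_le_gap hw)

theorem eq_of_lagrangian_eq (hw' : Q.IsSaddlePoint w') {x : E}
    (hx : Q.lagrangian w'.2 x = Q.lagrangian w'.2 w'.1) : x = w'.1 :=
  (strictConvexOn_lagrangian hw'.nonneg).eq_of_isMinOn (fun z _ => hx.trans_le (hw'.self_le z))
    (fun z _ => hw'.self_le z) (Set.mem_univ x) (Set.mem_univ w'.1)

theorem of_gap_eq_zero (hw' : Q.IsSaddlePoint w') (hfst : w.1 = w'.1) (hnonneg : 0 ≤ w.2)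
    (hgap : Q.gap w' w = 0) (hderiv : fderiv ℝ (Q.lagrangian w.2) w.1 = 0) :
    Q.IsSaddlePoint w where
  nonneg := hnonneg
  le_self y hy := by
    have hval : Q.lagrangian w'.2 w'.1 = Q.lagrangian w.2 w'.1 := by
      simpa only [gap, hfst, sub_eq_zero] using hgap
    rw [hfst, ← hval]
    exact hw'.le_self y hy
  self_le x := isMinOn_univ_of_convexOn_of_fderiv_eq_zero
    (strictConvexOn_lagrangian hnonneg).convexOn (differentiable_lagrangian _ _) hderiv
    (Set.mem_univ x)

theorem fst_mem_feasible (hw : Q.IsSaddlePoint w) : w.1 ∈ Q.feasible := fun j => by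
  classical
  have h := hw.le_self (w.2 + Pi.single j 1) (add_nonneg hw.nonneg (Pi.single_nonneg.2 one_pos.le))
  rw [← sub_nonpos, lagrangian_sub_lagrangian] at h
  simpa [Pi.single_apply] using h

theorem isMinOn_obj (hw : Q.IsSaddlePoint w) : IsMinOn Q.obj Q.feasible w.1 := fun x hx =>
  calc Q.obj w.1 = Q.lagrangian 0 w.1 := by simp [lagrangian]
    _ ≤ Q.lagrangian w.2 w.1 := hw.le_self 0 le_rfl
    _ ≤ Q.lagrangian w.2 x := hw.self_le x
    _ ≤ Q.obj x := add_le_of_nonpos_right <|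
      Finset.sum_nonpos fun j _ => mul_nonpos_of_nonneg_of_nonpos (hw.nonneg j) (hx j)

end IsSaddlePoint

end SaddlePoint

section Multipliers

variable {E ι : Type*} [NormedAddCommGroup E] [NormedSpace ℝ E] {Q : ConvexProgram E ι} {x : E}

/-- The constraint qualification that makes the linearized constraints at `x` describe the feasible
directions: a direction along which an active constraint is stationary does not violate it. -/
def IsQualified (Q : ConvexProgram E ι) (x : E) : Prop :=
  ∀ j v, Q.con j x = 0 → fderiv ℝ (Q.con j) x v = 0 →
    ∀ᶠ t in 𝓝[>] (0 : ℝ), Q.con j (x + t • v) ≤ 0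

theorem differentiable_obj : Differentiable ℝ Q.obj := Q.contDiff_obj.differentiable two_ne_zero

theorem differentiable_con (j : ι) : Differentiable ℝ (Q.con j) :=
  (Q.contDiff_con j).differentiable two_ne_zero

theorem eventually_con_add_smul_nonpos {j : ι} (hx : Q.con j x ≤ 0) {v : E}
    (hcq : Q.IsQualified x) (hv : Q.con j x = 0 → fderiv ℝ (Q.con j) x v ≤ 0) :
    ∀ᶠ t in 𝓝[>] (0 : ℝ), Q.con j (x + t • v) ≤ 0 := by
  have hderiv : HasDerivAt (fun t : ℝ => Q.con j (x + t • v)) (fderiv ℝ (Q.con j) x v) 0 :=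
    (differentiable_con j x).hasFDerivAt.hasLineDerivAt v
  rcases hx.lt_or_eq with hinactive | hactive
  · exact (hderiv.continuousAt.continuousWithinAt.eventually_lt_const
      (by simpa using hinactive)).mono fun t ht => ht.le
  · rcases (hv hactive).lt_or_eq with hdecrease | hstationary
    · filter_upwards [hderiv.hasDerivWithinAt.limsup_slope_le' (Set.notMem_Ioi.2 le_rfl) hdecrease,
        self_mem_nhdsWithin] with t hslope ht
      simpa [hactive] using ((slope_neg_iff_of_le (Set.mem_Ioi.1 ht).le).1 hslope).le
    · exact hcq j v hactive hstationary

theorem fderiv_obj_nonneg_of_isMinOn [Finite ι] (hx : x ∈ Q.feasible)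
    (hmin : IsMinOn Q.obj Q.feasible x) (hcq : Q.IsQualified x) {v : E}
    (hv : ∀ j, Q.con j x = 0 → fderiv ℝ (Q.con j) x v ≤ 0) :
    0 ≤ fderiv ℝ Q.obj x v := by
  have hfeas : ∀ᶠ t in 𝓝[>] (0 : ℝ), x + t • v ∈ Q.feasible :=
    eventually_all.2 fun j => eventually_con_add_smul_nonpos (hx j) hcq (hv j)
  exact hmin.localize.hasFDerivWithinAt_nonneg (differentiable_obj x).hasFDerivAt.hasFDerivWithinAt
    (mem_posTangentConeAt_of_frequently_mem hfeas.frequently)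

variable [Fintype ι]

theorem fderiv_lagrangian (y : ι → ℝ) (x : E) :
    fderiv ℝ (Q.lagrangian y) x = fderiv ℝ Q.obj x + ∑ j, y j • fderiv ℝ (Q.con j) x :=
  ((differentiable_obj x).hasFDerivAt.add (HasFDerivAt.fun_sum fun j _ =>
    (differentiable_con j x).hasFDerivAt.const_mul (y j))).fderiv

theorem isSaddlePoint_of_fderiv_eq_zero (hx : x ∈ Q.feasible) {y : ι → ℝ} (hy : 0 ≤ y)
    (hslack : ∀ j, y j * Q.con j x = 0) (hderiv : fderiv ℝ (Q.lagrangian y) x = 0) :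
    Q.IsSaddlePoint (x, y) where
  nonneg := hy
  le_self y' hy' := by
    rw [← sub_nonpos, lagrangian_sub_lagrangian]
    refine Finset.sum_nonpos fun j _ => ?_
    rw [sub_mul, hslack j, sub_zero]
    exact mul_nonpos_of_nonneg_of_nonpos (hy' j) (hx j)
  self_le x' := isMinOn_univ_of_convexOn_of_fderiv_eq_zero (strictConvexOn_lagrangian hy).convexOn
    (differentiable_lagrangian y x) hderiv (Set.mem_univ x')

theorem exists_isSaddlePoint_of_isMinOn (hx : x ∈ Q.feasible) (hmin : IsMinOn Q.obj Q.feasible x)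
    (hcq : Q.IsQualified x) : ∃ y, Q.IsSaddlePoint (x, y) := by
  classical
  let a (j : ι) : ℝ := if Q.con j x = 0 then 1 else 0
  have ha (j : ι) : 0 ≤ a j := by dsimp only [a]; split_ifs <;> norm_num
  obtain ⟨c, hc, hsum⟩ := exists_nonneg_sum_smul_eq_of_forall_nonpos
    (fun j => a j • (fderiv ℝ (Q.con j) x : E →ₗ[ℝ] ℝ)) (-(fderiv ℝ Q.obj x : E →ₗ[ℝ] ℝ))
    fun v hv => neg_nonpos.2 <| fderiv_obj_nonneg_of_isMinOn hx hmin hcq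
      fun j hj => by simpa [a, hj] using hv j
  refine ⟨fun j => c j * a j, isSaddlePoint_of_fderiv_eq_zero hx
    (fun j => mul_nonneg (hc j) (ha j)) (fun j => ?_) ?_⟩
  · by_cases hj : Q.con j x = 0 <;> simp [a, hj]
  · ext v
    have hv : ∑ j, c j * (a j * fderiv ℝ (Q.con j) x v) = -fderiv ℝ Q.obj x v := by
      simpa using LinearMap.congr_fun hsum v
    simp [fderiv_lagrangian, mul_assoc, hv]

end Multipliers

section SaddleField

variable {E ι : Type*} [NormedAddCommGroup E] [InnerProductSpace ℝ E] [CompleteSpace E]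
  [Fintype ι] (Q : ConvexProgram E ι) {w w' : E × (ι → ℝ)}

/-- Gradient descent of the Lagrangian in the point and gradient ascent in the multipliers, without
regard to the sign of the multipliers. -/
def lagrangianField (w : E × (ι → ℝ)) : E × (ι → ℝ) :=
  (-gradient (Q.lagrangian w.2) w.1, fun j => Q.con j w.1)

/-- Right-hand side of the saddle point dynamics. -/
def saddleField : E × (ι → ℝ) → E × (ι → ℝ) := projectedField Q.lagrangianField

variable {Q}

theorem contDiff_lagrangianField : ContDiff ℝ 1 Q.lagrangianField := by
  have hfderiv : ContDiff ℝ 1 fun w : E × (ι → ℝ) => fderiv ℝ (Q.lagrangian w.2) w.1 := by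
    simp only [fderiv_lagrangian]
    exact ((Q.contDiff_obj.fderiv_right one_add_one_eq_two.le).comp contDiff_fst).add <|
      ContDiff.sum fun j _ => ((contDiff_apply ℝ ℝ j).comp contDiff_snd).smul
        (((Q.contDiff_con j).fderiv_right one_add_one_eq_two.le).comp contDiff_fst)
  exact ((InnerProductSpace.toDual ℝ E).symm.contDiff.comp hfderiv).neg.prodMk <|
    contDiff_pi.2 fun j => ((Q.contDiff_con j).of_le one_le_two).comp contDiff_fst

theorem inner_lagrangianField_fst (w : E × (ι → ℝ)) (v : E) :
    inner ℝ v (Q.lagrangianField w).1 = -fderiv ℝ (Q.lagrangian w.2) w.1 v := by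
  rw [lagrangianField, inner_neg_right, real_inner_comm, inner_gradient_left]

theorem continuous_inner_lagrangianField_fst (v : E) :
    Continuous fun w => inner ℝ v (Q.lagrangianField w).1 :=
  continuous_const.inner (continuous_fst.comp contDiff_lagrangianField.continuous)

theorem innerSub_saddleField_le (hw' : 0 ≤ w'.2) (hw : 0 ≤ w.2) :
    innerSub w' w (Q.saddleField w) ≤ -Q.gap w' w := by
  have hfst : inner ℝ (w.1 - w'.1) (Q.saddleField w).1 ≤
      Q.lagrangian w.2 w'.1 - Q.lagrangian w.2 w.1 :=
    calc inner ℝ (w.1 - w'.1) (Q.lagrangianField w).1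
        = fderiv ℝ (Q.lagrangian w.2) w.1 (w'.1 - w.1) := by
          rw [inner_lagrangianField_fst, ← map_neg, neg_sub]
      _ ≤ _ := fderiv_sub_le_sub_of_convexOn (strictConvexOn_lagrangian hw).convexOn
          (differentiable_lagrangian w.2 w.1) w'.1
  have hsnd : ∑ j, (w.2 j - w'.2 j) * (Q.saddleField w).2 j ≤
      Q.lagrangian w.2 w.1 - Q.lagrangian w'.2 w.1 := by
    rw [lagrangian_sub_lagrangian]
    exact Finset.sum_le_sum fun j _ => sub_mul_projPlus_le (hw j) (hw' j)
  calc innerSub w' w (Q.saddleField w) ≤ _ := add_le_add hfst hsnd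
    _ = -Q.gap w' w := by rw [gap]; ring

/-- The factor `c` accommodates the truncated dynamics from which existence is derived. -/
theorem IsSaddlePoint.antitoneOn_sqDist (hw' : Q.IsSaddlePoint w') {z : ℝ → E × (ι → ℝ)} {c : ℝ → ℝ}
    (hc : ∀ t, 0 ≤ c t) (hnonneg : ∀ t, 0 ≤ t → 0 ≤ (z t).2)
    (hz : HasACDeriv z fun t => c t • Q.saddleField (z t)) :
    AntitoneOn (sqDist w' ∘ z) (Set.Ici 0) :=
  (hasACDeriv_sqDist hz w').antitoneOn <| .of_forall fun t ht => by
    have hdissipation := (innerSub_saddleField_le (Q := Q) hw'.nonneg (hnonneg t ht.le)).trans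
      (neg_nonpos.2 (hw'.gap_nonneg (hnonneg t ht.le)))
    rw [innerSub_smul]
    exact mul_nonpos_of_nonneg_of_nonpos zero_le_two
      (mul_nonpos_of_nonneg_of_nonpos (hc t) hdissipation)

end SaddleField

section Trajectory

variable {E ι : Type*} [NormedAddCommGroup E] [InnerProductSpace ℝ E] [Fintype ι]

/-- A solution on `[0, ∞)` of the saddle point dynamics, in the sense of Carathéodory, with
nonnegative multipliers. -/
structure IsTrajectory [CompleteSpace E] (Q : ConvexProgram E ι) (z : ℝ → E × (ι → ℝ)) :
    Prop where
  nonneg : ∀ t, 0 ≤ t → 0 ≤ (z t).2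
  hasACDeriv : HasACDeriv z fun t => Q.saddleField (z t)

namespace IsTrajectory

variable {w' : E × (ι → ℝ)} {z : ℝ → E × (ι → ℝ)} {t : ℝ}

section Complete

variable [CompleteSpace E] {Q : ConvexProgram E ι}

theorem antitoneOn_sqDist (hz : Q.IsTrajectory z) (hw' : Q.IsSaddlePoint w') :
    AntitoneOn (sqDist w' ∘ z) (Set.Ici 0) :=
  hw'.antitoneOn_sqDist (c := fun _ => 1) (fun _ => zero_le_one) hz.nonneg
    (by simpa only [one_smul] using hz.hasACDeriv)

theorem norm_sub_le (hz : Q.IsTrajectory z) (hw' : Q.IsSaddlePoint w') (ht : 0 ≤ t) :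
    ‖z t - w'‖ ≤ √(sqDist w' (z 0)) :=
  (norm_sub_le_sqrt_sqDist w' (z t)).trans <|
    Real.sqrt_le_sqrt (hz.antitoneOn_sqDist hw' Set.self_mem_Ici ht ht)

theorem mem_closedBall (hz : Q.IsTrajectory z) (hw' : Q.IsSaddlePoint w') (ht : 0 ≤ t) :
    z t ∈ Metric.closedBall w' √(sqDist w' (z 0)) :=
  mem_closedBall_iff_norm.2 (hz.norm_sub_le hw' ht)

theorem exists_tendsto_sqDist (hz : Q.IsTrajectory z) (hw' : Q.IsSaddlePoint w') :
    ∃ l, Tendsto (sqDist w' ∘ z) atTop (𝓝 l) :=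
  exists_tendsto_atTop_of_antitoneOn (hz.antitoneOn_sqDist hw') fun t => sqDist_nonneg w' (z t)

theorem abs_integral_gap_le (hz : Q.IsTrajectory z) (hw' : Q.IsSaddlePoint w')
    (hgap : ContinuousOn (fun t => Q.gap w' (z t)) (Set.Ici 0)) {s : ℝ} (hs : 0 ≤ s) (hst : s ≤ t) :
    |∫ r in s..t, Q.gap w' (z r)| ≤ |sqDist w' (z t) - sqDist w' (z s)| := by
  have hdist := hasACDeriv_sqDist hz.hasACDeriv w'
  have hnonneg (r : ℝ) (hr : r ∈ Set.Icc s t) : 0 ≤ Q.gap w' (z r) :=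
    hw'.gap_nonneg (hz.nonneg r (hs.trans hr.1))
  rw [abs_of_nonneg (intervalIntegral.integral_nonneg hst hnonneg), abs_sub_comm]
  refine le_trans ?_ (le_abs_self _)
  calc ∫ r in s..t, Q.gap w' (z r)
      ≤ ∫ r in s..t, -(2 * innerSub w' (z r) (Q.saddleField (z r))) := by
        refine intervalIntegral.integral_mono_on hst ?_ (hdist.intervalIntegrable hs hst).neg
          fun r hr => ?_
        · refine (hgap.mono ?_).intervalIntegrable
          rw [Set.uIcc_of_le hst]
          exact Set.Icc_subset_Ici_self.trans (Set.Ici_subset_Ici.2 hs)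
        · linarith [hnonneg r hr, innerSub_saddleField_le (Q := Q) hw'.nonneg
            (hz.nonneg r (hs.trans hr.1))]
    _ = sqDist w' (z s) - sqDist w' (z t) := by
        rw [intervalIntegral.integral_neg, hdist.integral_eq_sub hs hst, neg_sub]
        rfl

theorem tendsto_of_mapClusterPt (hz : Q.IsTrajectory z) {b : E × (ι → ℝ)}
    (hb : Q.IsSaddlePoint b) (hcluster : MapClusterPt b atTop z) : Tendsto z atTop (𝓝 b) := by
  obtain ⟨l, hl⟩ := hz.exists_tendsto_sqDist hb
  obtain rfl : sqDist b b = l :=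
    eq_of_mapClusterPt_of_tendsto hcluster (contDiff_sqDist b).continuous.continuousAt hl
  rw [tendsto_iff_norm_sub_tendsto_zero]
  refine squeeze_zero (fun _ => norm_nonneg _) (fun t => norm_sub_le_sqrt_sqDist b (z t)) ?_
  simpa [sqDist_self] using hl.sqrt

theorem eventually_forall_mem (hw' : Q.IsSaddlePoint w') {U : Set (E × (ι → ℝ))} (hU : U ∈ 𝓝 w') :
    ∀ᶠ w in 𝓝 w', ∀ z, Q.IsTrajectory z → z 0 = w → ∀ t, 0 ≤ t → z t ∈ U := by
  obtain ⟨ε, hε, hεU⟩ := Metric.mem_nhds_iff.1 hU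
  have hlim : Tendsto (fun w => √(sqDist w' w)) (𝓝 w') (𝓝 0) := by
    simpa [sqDist_self] using (contDiff_sqDist w').continuous.sqrt.tendsto w'
  filter_upwards [hlim.eventually_lt_const hε] with w hw z hz hzw t ht
  rw [← hzw] at hw
  exact hεU (mem_ball_iff_norm.2 ((hz.norm_sub_le hw' ht).trans_lt hw))

end Complete

variable [FiniteDimensional ℝ E] {Q : ConvexProgram E ι}

theorem uniformContinuousOn (hz : Q.IsTrajectory z) (hw' : Q.IsSaddlePoint w') :
    UniformContinuousOn z (Set.Ici 0) := by
  obtain ⟨C, hC⟩ := (isCompact_closedBall w' √(sqDist w' (z 0))).exists_bound_of_continuousOn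
    (contDiff_lagrangianField (Q := Q)).continuous.continuousOn
  have hfield (t : ℝ) (ht : 0 < t) : ‖Q.saddleField (z t)‖ ≤ C :=
    (norm_projectedField_le _ _).trans (hC _ (hz.mem_closedBall hw' ht.le))
  refine LipschitzOnWith.uniformContinuousOn (K := C.toNNReal) <|
    LipschitzOnWith.of_dist_le_mul fun s hs t ht => ?_
  wlog hts : t ≤ s generalizing s t
  · rw [dist_comm, dist_comm s]
    exact this t ht s hs (le_of_not_ge hts)
  rw [dist_eq_norm, Real.dist_eq, abs_of_nonneg (sub_nonneg.2 hts)]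
  exact (hz.hasACDeriv.norm_sub_le hfield ht hts).trans <|
    mul_le_mul_of_nonneg_right (Real.le_coe_toNNReal C) (sub_nonneg.2 hts)

theorem uniformContinuousOn_comp (hz : Q.IsTrajectory z) (hw' : Q.IsSaddlePoint w')
    {g : E × (ι → ℝ) → ℝ} (hg : Continuous g) :
    UniformContinuousOn (fun t => g (z t)) (Set.Ici 0) :=
  ((isCompact_closedBall w' √(sqDist w' (z 0))).uniformContinuousOn_of_continuous
    hg.continuousOn).comp (hz.uniformContinuousOn hw') fun _ ht => hz.mem_closedBall hw' ht

theorem tendsto_gap (hz : Q.IsTrajectory z) (hw' : Q.IsSaddlePoint w') :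
    Tendsto (fun t => Q.gap w' (z t)) atTop (𝓝 0) := by
  obtain ⟨l, hl⟩ := hz.exists_tendsto_sqDist hw'
  have hgap := hz.uniformContinuousOn_comp hw' (continuous_gap (Q := Q) w')
  exact tendsto_zero_of_abs_integral_le_abs_sub hl hgap fun s t hs hst =>
    hz.abs_integral_gap_le hw' hgap.continuousOn hs hst

theorem tendsto_fst (hz : Q.IsTrajectory z) (hw' : Q.IsSaddlePoint w') :
    Tendsto (fun t => (z t).1) atTop (𝓝 w'.1) := by
  have hexcess : Tendsto (fun t => Q.lagrangian w'.2 (z t).1 - Q.lagrangian w'.2 w'.1) atTop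
      (𝓝 0) := by
    refine tendsto_of_tendsto_of_tendsto_of_le_of_le' tendsto_const_nhds (hz.tendsto_gap hw')
      (.of_forall fun t => sub_nonneg.2 (hw'.self_le _)) ?_
    filter_upwards [eventually_ge_atTop 0] with t ht
    exact hw'.excess_le_gap (hz.nonneg t ht)
  refine ((isCompact_closedBall w' √(sqDist w' (z 0))).image
    continuous_fst).tendsto_nhds_of_unique_mapClusterPt ?_ fun x _ hx => ?_
  · filter_upwards [eventually_ge_atTop 0] with t ht
    exact Set.mem_image_of_mem _ (hz.mem_closedBall hw' ht)
  · have hcont : Continuous fun x => Q.lagrangian w'.2 x - Q.lagrangian w'.2 w'.1 :=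
      (contDiff_lagrangian w'.2).continuous.sub continuous_const
    have hzero := eq_of_mapClusterPt_of_tendsto hx hcont.continuousAt hexcess
    exact hw'.eq_of_lagrangian_eq (sub_eq_zero.1 hzero)

theorem tendsto_inner_lagrangianField_fst (hz : Q.IsTrajectory z) (hw' : Q.IsSaddlePoint w')
    (v : E) :
    Tendsto (fun t => inner ℝ v (Q.lagrangianField (z t)).1) atTop (𝓝 0) := by
  have hlim : Tendsto (fun t => inner ℝ v (z t).1) atTop (𝓝 (inner ℝ v w'.1)) :=
    tendsto_const_nhds.inner (hz.tendsto_fst hw')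
  refine tendsto_zero_of_abs_integral_le_abs_sub hlim (hz.uniformContinuousOn_comp hw'
    (continuous_inner_lagrangianField_fst v)) fun s t hs hst => ?_
  have hint := (hz.hasACDeriv.clm_comp
    (innerSL ℝ v ∘L ContinuousLinearMap.fst ℝ E (ι → ℝ))).integral_eq_sub hs hst
  exact (congrArg abs hint).le

theorem isSaddlePoint_of_mapClusterPt (hz : Q.IsTrajectory z) (hw' : Q.IsSaddlePoint w')
    {b : E × (ι → ℝ)} (hb : MapClusterPt b atTop z) : Q.IsSaddlePoint b := by
  have hfst : b.1 = w'.1 :=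
    eq_of_mapClusterPt_of_tendsto hb continuous_fst.continuousAt (hz.tendsto_fst hw')
  have hnonneg : 0 ≤ b.2 := by
    refine (isClosed_Ici.preimage continuous_snd).mem_of_mapClusterPt hb ?_
    filter_upwards [eventually_ge_atTop 0] with t ht using hz.nonneg t ht
  have hgap : Q.gap w' b = 0 :=
    eq_of_mapClusterPt_of_tendsto hb (continuous_gap w').continuousAt (hz.tendsto_gap hw')
  refine hw'.of_gap_eq_zero hfst hnonneg hgap (ContinuousLinearMap.ext fun v => ?_)
  have hinner := eq_of_mapClusterPt_of_tendsto hb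
    (continuous_inner_lagrangianField_fst v).continuousAt
    (hz.tendsto_inner_lagrangianField_fst hw' v)
  rwa [inner_lagrangianField_fst, neg_eq_zero] at hinner

theorem exists_tendsto (hz : Q.IsTrajectory z) (hw' : Q.IsSaddlePoint w') :
    ∃ b, Q.IsSaddlePoint b ∧ Tendsto z atTop (𝓝 b) := by
  have hmem : ∀ᶠ t in atTop, z t ∈ Metric.closedBall w' √(sqDist w' (z 0)) :=
    (eventually_ge_atTop 0).mono fun t ht => hz.mem_closedBall hw' ht
  obtain ⟨b, -, hcluster⟩ := (isCompact_closedBall _ _).exists_mapClusterPt_of_frequently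
    hmem.frequently
  have hb := hz.isSaddlePoint_of_mapClusterPt hw' hcluster
  exact ⟨b, hb, hz.tendsto_of_mapClusterPt hb hcluster⟩

end IsTrajectory

theorem IsSaddlePoint.exists_isTrajectory [FiniteDimensional ℝ E] {Q : ConvexProgram E ι}
    {w' z₀ : E × (ι → ℝ)} (hw' : Q.IsSaddlePoint w') (hz₀ : 0 ≤ z₀.2) :
    ∃ z, z 0 = z₀ ∧ Q.IsTrajectory z := by
  let ρ : ContDiffBump w' :=
    ⟨√(sqDist w' z₀) + 1, √(sqDist w' z₀) + 2, by positivity, by linarith⟩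
  have hsmooth : ContDiff ℝ 1 fun w => ρ w • Q.lagrangianField w :=
    ρ.contDiff.smul contDiff_lagrangianField
  have hsupp : HasCompactSupport fun w => ρ w • Q.lagrangianField w :=
    ρ.hasCompactSupport.smul_right
  obtain ⟨K, hK⟩ := hsmooth.lipschitzWith_of_hasCompactSupport hsupp one_ne_zero
  obtain ⟨M, hM⟩ := hsupp.exists_bound_of_continuous hsmooth.continuous
  obtain ⟨z, hz0, hnonneg, hz⟩ := exists_hasACDeriv_projectedField hK hM hz₀
  simp only [projectedField_smul fun _ => ρ.nonneg] at hz
  have hρ (t : ℝ) (ht : 0 ≤ t) : ρ (z t) = 1 := by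
    refine ρ.one_of_mem_closedBall (mem_closedBall_iff_norm.2 ?_)
    calc ‖z t - w'‖ ≤ √(sqDist w' (z t)) := norm_sub_le_sqrt_sqDist w' (z t)
      _ ≤ √(sqDist w' (z 0)) := Real.sqrt_le_sqrt <|
        hw'.antitoneOn_sqDist (fun _ => ρ.nonneg) hnonneg hz Set.self_mem_Ici ht ht
      _ ≤ √(sqDist w' z₀) + 1 := by rw [hz0]; exact le_add_of_nonneg_right zero_le_one
  refine ⟨z, hz0, hnonneg, hz.absCont, hz.hasDerivAt.mono fun t hderiv ht => ?_⟩
  have hzt := hderiv ht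
  rwa [hρ t ht.le, one_smul] at hzt

end Trajectory

end ConvexProgram

namespace PowerGrid

variable {nb n : ℕ} (N : PowerGrid nb n) (m : ℕ)

/-- The transmission power `P^m_{ij}` as a linear functional of the injected power. -/
def flowCLM (i j : Fin nb) : EuclideanSpace ℝ (Fin nb) →L[ℝ] ℝ :=
  LinearMap.toContinuousLinearMap
    { toFun := fun P => N.flowAt m P i j
      map_add' := fun P P' => by
        simp only [flowAt, flow, WithLp.ofLp_add, Matrix.mulVec_add, Pi.add_apply]
        ring
      map_smul' := fun r P => by
        simp only [flowAt, flow, WithLp.ofLp_smul, Matrix.mulVec_smul, Pi.smul_apply, smul_eq_mul,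
          RingHom.id_apply]
        ring }

theorem flowCLM_apply (i j : Fin nb) (P : EuclideanSpace ℝ (Fin nb)) :
    N.flowCLM m i j P = N.flowAt m P i j := rfl

/-- The constraints of the load-shedding problem, in the form `constraint j P ≤ 0`: the thresholds
of the transmission power, the upper bounds and the lower bounds. -/
def constraint : N.Edge ⊕ Fin nb ⊕ Fin nb → EuclideanSpace ℝ (Fin nb) → ℝ
  | .inl e, P => N.flowAt m P e.1.1 e.1.2 ^ 2 - N.σ e.1.1 e.1.2 ^ 2
  | .inr (.inl i), P => P i - N.Phi i
  | .inr (.inr i), P => N.Plo i - P i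

theorem contDiff_constraint (j : N.Edge ⊕ Fin nb ⊕ Fin nb) : ContDiff ℝ 2 (N.constraint m j) := by
  rcases j with e | i | i
  · exact ((N.flowCLM m e.1.1 e.1.2).contDiff.pow 2).sub contDiff_const
  · exact (EuclideanSpace.proj i : _ →L[ℝ] ℝ).contDiff.sub contDiff_const
  · exact contDiff_const.sub (EuclideanSpace.proj i : _ →L[ℝ] ℝ).contDiff

theorem convexOn_constraint (j : N.Edge ⊕ Fin nb ⊕ Fin nb) :
    ConvexOn ℝ Set.univ (N.constraint m j) := by
  rcases j with e | i | i
  · exact (even_two.convexOn_pow.comp_linearMap (N.flowCLM m e.1.1 e.1.2).toLinearMap).sub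
      (concaveOn_const _ convex_univ)
  · exact ((EuclideanSpace.proj i : _ →L[ℝ] ℝ).toLinearMap.convexOn convex_univ).sub
      (concaveOn_const _ convex_univ)
  · exact (convexOn_const _ convex_univ).sub
      ((EuclideanSpace.proj i : _ →L[ℝ] ℝ).toLinearMap.concaveOn convex_univ)

theorem contDiff_cost : ContDiff ℝ 2 N.cost :=
  ContDiff.norm_sq ℝ (by fun_prop)

theorem strictConvexOn_cost (hW : ∀ i, 0 < N.W i) : StrictConvexOn ℝ Set.univ N.cost := by
  let L : EuclideanSpace ℝ (Fin nb) →ₗ[ℝ] EuclideanSpace ℝ (Fin nb) :=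
    Matrix.toEuclideanLin (Matrix.diagonal N.W)
  have hL (P : EuclideanSpace ℝ (Fin nb)) (i : Fin nb) : L P i = N.W i * P i := by
    simp [L, Matrix.toLpLin_apply, Matrix.mulVec_diagonal]
  have hinj : Function.Injective L := fun P P' h => by
    ext i
    have hi := congrArg (fun P : EuclideanSpace ℝ (Fin nb) => P i) h
    exact mul_left_cancel₀ (hW i).ne' (by simpa only [hL] using hi)
  have hcost (P : EuclideanSpace ℝ (Fin nb)) : N.cost P = ‖L P - L N.P0‖ ^ 2 := by
    rw [cost]
    congr 2
    ext i
    simp only [hL, PiLp.sub_apply, mul_sub]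
  rw [funext hcost]
  exact strictConvexOn_norm_map_sub_sq hinj _

/-- The load-shedding problem as a convex program. -/
def program (hW : ∀ i, 0 < N.W i) :
    ConvexProgram (EuclideanSpace ℝ (Fin nb)) (N.Edge ⊕ Fin nb ⊕ Fin nb) where
  obj := N.cost
  con := N.constraint m
  contDiff_obj := N.contDiff_cost
  contDiff_con := N.contDiff_constraint m
  strictConvexOn_obj := N.strictConvexOn_cost hW
  convexOn_con := N.convexOn_constraint m

/-- The states of the saddle point dynamics as pairs of a point and a vector of multipliers. -/
def coords : N.State ≃L[ℝ] EuclideanSpace ℝ (Fin nb) × (N.Edge ⊕ Fin nb ⊕ Fin nb → ℝ) :=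
  (ContinuousLinearEquiv.refl ℝ _).prodCongr <|
    ((EuclideanSpace.equiv _ ℝ).prodCongr <|
      ((EuclideanSpace.equiv _ ℝ).prodCongr (EuclideanSpace.equiv _ ℝ)).trans
        (ContinuousLinearEquiv.sumPiEquivProdPi ℝ _ _ fun _ => ℝ).symm).trans
      (ContinuousLinearEquiv.sumPiEquivProdPi ℝ _ _ fun _ => ℝ).symm

variable {N}

theorem coords_fst (z : N.State) : (N.coords z).1 = z.1 := rfl

theorem coords_snd (z : N.State) :
    (N.coords z).2 = Sum.elim z.2.1.ofLp (Sum.elim z.2.2.1.ofLp z.2.2.2.ofLp) := by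
  funext j
  rcases j with e | i | i <;> rfl

theorem multNonneg_iff {z : N.State} : N.MultNonneg z ↔ 0 ≤ (N.coords z).2 := by
  simp [MultNonneg, coords_snd, Pi.le_def, Sum.forall]

variable {m}

theorem gradient_lagrangian_edge (z : N.State) :
    gradient (fun lam => N.lagrangian m z.1 lam z.2.2.1 z.2.2.2) z.2.1 =
      WithLp.toLp 2 fun e => N.constraint m (.inl e) z.1 := by
  convert! (hasGradientAt_const_add_sum_mul (N.cost z.1 +
    ∑ i, z.2.2.1 i * (z.1 i - N.Phi i) + ∑ i, z.2.2.2 i * (N.Plo i - z.1 i)) _ _).gradient using 2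
  funext lam
  simp only [lagrangian, constraint]
  ring

theorem gradient_lagrangian_upper (z : N.State) :
    gradient (fun tu => N.lagrangian m z.1 z.2.1 tu z.2.2.2) z.2.2.1 =
      WithLp.toLp 2 fun i => N.constraint m (.inr (.inl i)) z.1 := by
  convert! (hasGradientAt_const_add_sum_mul (N.cost z.1 +
    ∑ e, z.2.1 e * N.constraint m (.inl e) z.1 + ∑ i, z.2.2.2 i * (N.Plo i - z.1 i)) _ _).gradient
    using 2
  funext tu
  simp only [lagrangian, constraint]
  ring

theorem gradient_lagrangian_lower (z : N.State) :
    gradient (fun tl => N.lagrangian m z.1 z.2.1 z.2.2.1 tl) z.2.2.2 =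
      WithLp.toLp 2 fun i => N.constraint m (.inr (.inr i)) z.1 :=
  (hasGradientAt_const_add_sum_mul _ _ _).gradient

theorem feasible_eq_setOf_constraint : N.feasible m = {P | ∀ j, N.constraint m j P ≤ 0} := by
  ext P
  simp only [feasible, Set.mem_ofPred_eq, Sum.forall, constraint, sub_nonpos, forall_and]
  rw [and_comm (a := ∀ i, P i ≤ N.Phi i)]

theorem isCompact_feasible : IsCompact (N.feasible m) := by
  have hclosed : IsClosed (N.feasible m) := by
    simp only [feasible_eq_setOf_constraint, Set.ofPred_forall]
    exact isClosed_iInter fun j => isClosed_le (N.contDiff_constraint m j).continuous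
      continuous_const
  exact (isCompact_Icc.image (PiLp.continuous_toLp 2 _)).of_isClosed_subset hclosed
    fun P hP => ⟨P.ofLp, ⟨fun i => (hP.2 i).1, fun i => (hP.2 i).2⟩, rfl⟩

theorem exists_isOptimal (hfeas : (N.feasible m).Nonempty) : ∃ P, N.IsOptimal m P :=
  isCompact_feasible.exists_isMinOn hfeas N.contDiff_cost.continuous.continuousOn

theorem flowAt_ne_zero_of_constraint_eq_zero {e : N.Edge} (hσ : 0 < N.σ e.1.1 e.1.2)
    {P : EuclideanSpace ℝ (Fin nb)} (hactive : N.constraint m (.inl e) P = 0) :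
    N.flowAt m P e.1.1 e.1.2 ≠ 0 := by
  rw [← pow_ne_zero_iff two_ne_zero, sub_eq_zero.1 hactive]
  exact (pow_pos hσ 2).ne'

theorem constraint_add_smul_of_fderiv_eq_zero {j : N.Edge ⊕ Fin nb ⊕ Fin nb}
    (hσ : ∀ e : N.Edge, 0 < N.σ e.1.1 e.1.2) {P v : EuclideanSpace ℝ (Fin nb)}
    (hactive : N.constraint m j P = 0) (hderiv : fderiv ℝ (N.constraint m j) P v = 0) (t : ℝ) :
    N.constraint m j (P + t • v) = 0 := by
  rw [← hactive]
  rcases j with e | i | i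
  · have h : HasFDerivAt (N.constraint m (.inl e)) _ P :=
      ((N.flowCLM m e.1.1 e.1.2).hasFDerivAt.pow 2).sub_const _
    have hv : N.flowCLM m e.1.1 e.1.2 v = 0 := by
      simpa [h.fderiv, flowCLM_apply, flowAt_ne_zero_of_constraint_eq_zero (hσ e) hactive]
        using hderiv
    simp only [constraint, ← flowCLM_apply, map_add, map_smul, hv, smul_zero, add_zero]
  · have h : HasFDerivAt (N.constraint m (.inr (.inl i))) _ P :=
      (EuclideanSpace.proj i : _ →L[ℝ] ℝ).hasFDerivAt.sub_const _
    have hv : v i = 0 := by simpa [h.fderiv] using hderiv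
    simp [constraint, hv]
  · have h : HasFDerivAt (N.constraint m (.inr (.inr i))) _ P :=
      (EuclideanSpace.proj i : _ →L[ℝ] ℝ).hasFDerivAt.const_sub _
    have hv : v i = 0 := by simpa [h.fderiv] using hderiv
    simp [constraint, hv]

section Program

variable (hW : ∀ i, 0 < N.W i)

theorem isQualified_program (hσ : ∀ e : N.Edge, 0 < N.σ e.1.1 e.1.2)
    (P : EuclideanSpace ℝ (Fin nb)) : (N.program m hW).IsQualified P :=
  fun _ _ hactive hderiv => .of_forall fun t =>
    (constraint_add_smul_of_fderiv_eq_zero hσ hactive hderiv t).le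

theorem isOptimal_iff {P : EuclideanSpace ℝ (Fin nb)} : N.IsOptimal m P ↔
    P ∈ (N.program m hW).feasible ∧ IsMinOn (N.program m hW).obj (N.program m hW).feasible P := by
  rw [IsOptimal, feasible_eq_setOf_constraint]
  rfl

theorem lagrangian_program (P : EuclideanSpace ℝ (Fin nb)) (z : N.State) :
    (N.program m hW).lagrangian (N.coords z).2 P = N.lagrangian m P z.2.1 z.2.2.1 z.2.2.2 := by
  simp only [ConvexProgram.lagrangian, lagrangian, program, coords_snd, constraint,
    Fintype.sum_sum_type, Sum.elim_inl, Sum.elim_inr, add_assoc]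

theorem isSaddlePoint_program {z : N.State} :
    (N.program m hW).IsSaddlePoint (N.coords z) ↔ N.IsSaddlePoint m z := by
  refine ⟨fun h => ⟨multNonneg_iff.2 h.nonneg, fun w hw => ?_⟩, fun h => ⟨multNonneg_iff.1 h.1,
    fun y hy => ?_, fun P => ?_⟩⟩
  · simp only [← lagrangian_program hW]
    exact ⟨h.le_self _ (multNonneg_iff.1 hw), h.self_le w.1⟩
  · obtain ⟨w, hw⟩ := N.coords.surjective (z.1, y)
    obtain rfl : (N.coords w).2 = y := congrArg Prod.snd hw
    simp only [lagrangian_program, coords_fst]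
    exact (h.2 w (multNonneg_iff.2 hy)).1
  · simp only [lagrangian_program, coords_fst]
    exact (h.2 (P, z.2) h.1).2

theorem coords_saddleField (z : N.State) :
    N.coords (N.saddleField m z) = (N.program m hW).saddleField (N.coords z) := by
  refine Prod.ext ?_ ?_
  · simp only [coords_fst, saddleField, ConvexProgram.saddleField, projectedField,
      ConvexProgram.lagrangianField, ← lagrangian_program hW]
  · rw [coords_snd, saddleField, gradient_lagrangian_edge, gradient_lagrangian_upper,
      gradient_lagrangian_lower]
    funext j
    rcases j with e | i | i <;> rfl

theorem isTrajectory_program {z : ℝ → N.State} :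
    (N.program m hW).IsTrajectory (fun t => N.coords (z t)) ↔ N.IsTrajectory m z := by
  have hac : HasACDeriv (fun t => N.coords (z t))
      (fun t => (N.program m hW).saddleField (N.coords (z t))) ↔
      HasACDeriv z fun t => N.saddleField m (z t) := by
    simp only [← coords_saddleField hW, hasACDeriv_equiv_comp_iff]
  exact ⟨fun h => ⟨(hac.1 h.2).1, fun t ht => multNonneg_iff.2 (h.1 t ht), (hac.1 h.2).2⟩,
    fun h => ⟨fun t ht => multNonneg_iff.1 (h.2 t ht), hac.2 ⟨h.1, h.3⟩⟩⟩

end Program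

theorem IsOptimal.eq (hW : ∀ i, 0 < N.W i) {P Q : EuclideanSpace ℝ (Fin nb)} (hP : N.IsOptimal m P)
    (hQ : N.IsOptimal m Q) : P = Q := by
  rw [isOptimal_iff hW] at hP hQ
  exact ConvexProgram.eq_of_isMinOn_feasible hP.1 hQ.1 hP.2 hQ.2

theorem IsOptimal.exists_isSaddlePoint (hW : ∀ i, 0 < N.W i)
    (hσ : ∀ e : N.Edge, 0 < N.σ e.1.1 e.1.2) {P : EuclideanSpace ℝ (Fin nb)}
    (hP : N.IsOptimal m P) : ∃ y, N.IsSaddlePoint m (P, y) := by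
  rw [isOptimal_iff hW] at hP
  obtain ⟨y, hy⟩ := ConvexProgram.exists_isSaddlePoint_of_isMinOn hP.1 hP.2
    (isQualified_program hW hσ P)
  obtain ⟨z, hz⟩ := N.coords.surjective (P, y)
  obtain rfl : z.1 = P := congrArg Prod.fst hz
  exact ⟨z.2, (isSaddlePoint_program hW).1 (hz ▸ hy)⟩

namespace IsSaddlePoint

variable {w : N.State}

theorem isOptimal (hW : ∀ i, 0 < N.W i) (hw : N.IsSaddlePoint m w) : N.IsOptimal m w.1 :=
  have h := (isSaddlePoint_program hW).2 hw
  (isOptimal_iff hW).2 ⟨h.fst_mem_feasible, h.isMinOn_obj⟩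

theorem exists_isTrajectory (hW : ∀ i, 0 < N.W i) (hw : N.IsSaddlePoint m w) {z₀ : N.State}
    (hz₀ : N.MultNonneg z₀) : ∃ z, N.IsTrajectory m z ∧ z 0 = z₀ := by
  obtain ⟨z, hz0, hz⟩ :=
    ((isSaddlePoint_program hW).2 hw).exists_isTrajectory (multNonneg_iff.1 hz₀)
  refine ⟨fun t => N.coords.symm (z t), (isTrajectory_program hW).1 ?_, by simp [hz0]⟩
  simpa only [ContinuousLinearEquiv.apply_symm_apply] using hz

theorem exists_tendsto (hW : ∀ i, 0 < N.W i) (hw : N.IsSaddlePoint m w) {z : ℝ → N.State}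
    (hz : N.IsTrajectory m z) : ∃ w', N.IsSaddlePoint m w' ∧ Tendsto z atTop (𝓝 w') := by
  obtain ⟨b, hb, hlim⟩ := ((isTrajectory_program hW).2 hz).exists_tendsto
    ((isSaddlePoint_program hW).2 hw)
  obtain ⟨w', rfl⟩ := N.coords.surjective b
  refine ⟨w', (isSaddlePoint_program hW).1 hb, ?_⟩
  simpa [Function.comp_def] using (N.coords.symm.continuous.tendsto _).comp hlim

theorem eventually_forall_mem (hW : ∀ i, 0 < N.W i) (hw : N.IsSaddlePoint m w) {U : Set N.State}
    (hU : U ∈ 𝓝 w) : ∀ᶠ z₀ in 𝓝 w, ∀ z, N.IsTrajectory m z → z 0 = z₀ → ∀ t, 0 ≤ t → z t ∈ U := by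
  have hU' : N.coords.symm ⁻¹' U ∈ 𝓝 (N.coords w) :=
    N.coords.symm.continuous.continuousAt.preimage_mem_nhds (by simpa using hU)
  have hstable := ConvexProgram.IsTrajectory.eventually_forall_mem
    ((isSaddlePoint_program hW).2 hw) hU'
  filter_upwards [(N.coords.continuous.tendsto w).eventually hstable] with z₀ hz₀ z hz hz0 t ht
  simpa using hz₀ _ ((isTrajectory_program hW).2 hz) (congrArg N.coords hz0) t ht

end IsSaddlePoint

end PowerGrid

theorem proposition4 {nb n : ℕ} (N : PowerGrid nb n) (m : ℕ)
    (hW : ∀ i, 0 < N.W i)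
    (hσ : ∀ e : N.Edge, 0 < N.σ e.1.1 e.1.2)
    (hfeas : (N.feasible m).Nonempty) :
    ∃ Pstar : EuclideanSpace ℝ (Fin nb),
      -- `Pstar` is the unique optimal solution
      (N.IsOptimal m Pstar ∧ ∀ Q, N.IsOptimal m Q → Q = Pstar) ∧
      -- from every initial state there is a solution for all times
      (∀ z₀ : N.State, N.MultNonneg z₀ → ∃ z, N.IsTrajectory m z ∧ z 0 = z₀) ∧
      -- every solution converges to a saddle point whose power vector is `Pstar`
      (∀ z, N.IsTrajectory m z →
        ∃ zstar : N.State, zstar.1 = Pstar ∧ N.IsSaddlePoint m zstar ∧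
          Filter.Tendsto z Filter.atTop (nhds zstar)) ∧
      -- every saddle point is Lyapunov stable
      (∀ zstar : N.State, N.IsSaddlePoint m zstar →
        ∀ ε > 0, ∃ δ > 0, ∀ z, N.IsTrajectory m z → dist (z 0) zstar < δ →
          ∀ t, 0 ≤ t → dist (z t) zstar < ε) := by
  obtain ⟨P, hP⟩ := PowerGrid.exists_isOptimal hfeas
  obtain ⟨y, hy⟩ := hP.exists_isSaddlePoint hW hσ
  refine ⟨P, ⟨hP, fun Q hQ => hQ.eq hW hP⟩, fun z₀ hz₀ => hy.exists_isTrajectory hW hz₀,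
    fun z hz => ?_, fun w hw ε hε => ?_⟩
  · obtain ⟨w, hw, hlim⟩ := hy.exists_tendsto hW hz
    exact ⟨w, (hw.isOptimal hW).eq hW hP, hw, hlim⟩
  · obtain ⟨δ, hδ, hstable⟩ := Metric.eventually_nhds_iff.1 <|
      hw.eventually_forall_mem hW (Metric.ball_mem_nhds w hε)
    exact ⟨δ, hδ, fun z hz hz0 => hstable hz0 z hz rfl⟩

end
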